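/- Let $\Omega\subseteq\mathbb C$ be an arbitrary open set, and let $H(\Omega)$ be the space of holomorphic functions on $\Omega$ with the topology of uniform convergence on compact subsets of $\Omega$. For $f\in H(\Omega)$ and $\zeta\in\Omega$ let $\sum_{v\ge 0}a_v(z-\zeta)^v$ be the Taylor series of $f$ at $\zeta$, and put $a_i=0$ for $i<0$. For $p,q\in\{0,1,2,\dots\}$ write $f\in\mathcal D_{p,q}(\zeta)$ if the $q\times q$ Hankel determinant $\det\big(a_{p-q+1+i+j}\big)_{0\le i,j\le q-1}$ is nonzero (for $q=0$ this always holds). In that case there is a unique rational function $[p/q]_{f,\zeta}$ of the form $$\frac{\sum_{v=0}^p n_v(z-\zeta)^v}{\sum_{v=0}^q d_v(z-\zeta)^v},\qquad d_0=1,$$ whose Taylor series at $\zeta$ has the coefficients $a_0,\dots,a_{p+q}$ in degrees $0,\dots,p+q$; it is called the Padé approximant of $f$ at $\zeta$. **Theorem 5.5.** Let $\mathcal F\subseteq\mathbb N\times\mathbb N$, where $\mathbb N=\{0,1,2,\dots\}$, contain a sequence $(\tilde p_n,\tilde q_n)$ with $\tilde p_n\to+\infty$ and $\tilde q_n\to+\infty$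 as $n\to+\infty$, and let $\zeta_0\in\Omega$. Then there exists $f\in H(\Omega)$ with the following property: there is a sequence $(p_n,q_n)_{n\in\mathbb N}$ in $\mathcal F$ such that $f\in\mathcal D_{p_n,q_n}(\zeta_0)$ for all $n$, and for every compact set $K\subseteq\Omega$ $$\sup_{z\in K}\big|[p_n/q_n]_{f,\zeta_0}(z)-f(z)\big|\to 0\quad\text{as } n\to+\infty,$$ where the supremum is $+\infty$ if $[p_n/q_n]_{f,\zeta_0}$ has a pole in $K$ (so that it has no poles in $K$ for all sufficiently large $n$). Moreover, the set of all $f\in H(\Omega)$ with this property is a $G_\delta$ and dense subset of $H(\Omega)$. -/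

import Mathlib

open Filter Topology Polynomial

noncomputable section

namespace PadeGeneric

/-! ### Padé approximants of a formal power series -/

/-- The coefficient `a_k` of a formal power series, for an integer index `k`,
with `a_k = 0` for `k < 0`. -/
def coeffInt (a : PowerSeries ℂ) (k : ℤ) : ℂ :=
  if k < 0 then 0 else PowerSeries.coeff k.toNat a

/-- The `q × q` Hankel matrix with rows `(a_{p-q+1}, …, a_p)`, …, `(a_p, …, a_{p+q-1})`. -/
def hankelMatrix (a : PowerSeries ℂ) (p q : ℕ) : Matrix (Fin q) (Fin q) ℂ :=
  Matrix.of fun i j => coeffInt a ((p : ℤ) - q + 1 + (i : ℕ) + (j : ℕ))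

/-- The Hankel determinant is nonzero (for `q = 0` the empty determinant is `1`, so the
condition always holds). -/
def HankelNonzero (a : PowerSeries ℂ) (p q : ℕ) : Prop :=
  (hankelMatrix a p q).det ≠ 0

/-- `R` is a `[p/q]` Padé approximant of the formal series `a` (all in the local variable
`w = z - ζ`): `R = P / Q` with `deg P ≤ p`, `deg Q ≤ q`, `Q(0) = 1`, and the Taylor series
`P * Q⁻¹` of `R` at `w = 0` agrees with `a` in the terms of order `0, …, p + q`. -/
def IsPade (a : PowerSeries ℂ) (p q : ℕ) (R : RatFunc ℂ) : Prop :=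
  ∃ P Q : ℂ[X], P.natDegree ≤ p ∧ Q.natDegree ≤ q ∧ Q.coeff 0 = 1 ∧
    R = algebraMap ℂ[X] (RatFunc ℂ) P / algebraMap ℂ[X] (RatFunc ℂ) Q ∧
    ∀ v ≤ p + q,
      PowerSeries.coeff v ((P : PowerSeries ℂ) * (Q : PowerSeries ℂ)⁻¹) = PowerSeries.coeff v a

lemma coeff_mul_hankel (a : PowerSeries ℂ) (p q : ℕ) (Q : ℂ[X]) (hQ : Q.natDegree ≤ q)
    (h0 : Q.coeff 0 = 1) (i : Fin q) :
    PowerSeries.coeff (p + 1 + i) ((Q : PowerSeries ℂ) * a) =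
      PowerSeries.coeff (p + 1 + i) a +
        (hankelMatrix a p q).mulVec (fun j => Q.coeff (q - j)) i := by
  set n : ℕ := p + 1 + i with hn
  have h1 : PowerSeries.coeff n ((Q : PowerSeries ℂ) * a) =
      ∑ k ∈ Finset.range (n + 1 + q), Q.coeff k * coeffInt a ((n : ℤ) - k) := by
    rw [PowerSeries.coeff_mul, Finset.Nat.sum_antidiagonal_eq_sum_range_succ_mk]
    rw [← Finset.sum_subset (Finset.range_mono (by omega : n + 1 ≤ n + 1 + q))]
    · refine Finset.sum_congr rfl fun k hk => ?_
      rw [Finset.mem_range] at hk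
      have e : ((n : ℤ) - k).toNat = n - k := by omega
      simp only [Polynomial.coeff_coe, coeffInt, e]
      rw [if_neg (by omega)]
    · intro k _ hk
      rw [Finset.mem_range] at hk
      rw [coeffInt, if_pos (by omega), mul_zero]
  have h2 : ∑ k ∈ Finset.range (n + 1 + q), Q.coeff k * coeffInt a ((n : ℤ) - k) =
      ∑ k ∈ Finset.range (q + 1), Q.coeff k * coeffInt a ((n : ℤ) - k) := by
    symm
    refine Finset.sum_subset (Finset.range_mono (by omega)) ?_
    intro k _ hk
    rw [Finset.mem_range] at hk
    rw [Polynomial.coeff_eq_zero_of_natDegree_lt (by omega), zero_mul]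
  rw [h1, h2, Finset.sum_range_succ', add_comm]
  congr 1
  · rw [h0, one_mul, coeffInt, if_neg (by omega)]
    congr 2
  · rw [← Finset.sum_range_reflect, Matrix.mulVec, dotProduct, Finset.sum_range]
    refine Finset.sum_congr rfl fun j _ => ?_
    have hj := j.2
    rw [hankelMatrix, Matrix.of_apply, mul_comm]
    have e1 : q - 1 - (j : ℕ) + 1 = q - j := by omega
    have e2 : (n : ℤ) - ((q - 1 - (j : ℕ) + 1 : ℕ) : ℤ) =
        (p : ℤ) - q + 1 + (i : ℕ) + (j : ℕ) := by omega
    rw [e2, e1]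

lemma agree_iff (a : PowerSeries ℂ) (p q : ℕ) (P Q : ℂ[X]) (h0 : Q.coeff 0 = 1) :
    (∀ v ≤ p + q, PowerSeries.coeff v ((P : PowerSeries ℂ) * (Q : PowerSeries ℂ)⁻¹) =
        PowerSeries.coeff v a) ↔
      ∀ v ≤ p + q, PowerSeries.coeff v ((Q : PowerSeries ℂ) * a) = P.coeff v := by
  have hc : PowerSeries.constantCoeff (Q : PowerSeries ℂ) ≠ 0 := by simp [h0]
  have hQ : (Q : PowerSeries ℂ) * (Q : PowerSeries ℂ)⁻¹ = 1 := PowerSeries.mul_inv_cancel _ hc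
  have key : ∀ f g : PowerSeries ℂ, (∀ v ≤ p + q, PowerSeries.coeff v f = PowerSeries.coeff v g) ↔
      PowerSeries.X ^ (p + q + 1) ∣ f - g := by
    intro f g
    rw [PowerSeries.X_pow_dvd_iff]
    refine forall_congr' fun v => ?_
    rw [Nat.lt_succ_iff, map_sub, sub_eq_zero]
  have e : (∀ v ≤ p + q, PowerSeries.coeff v ((Q : PowerSeries ℂ) * a) = P.coeff v) ↔
      ∀ v ≤ p + q, PowerSeries.coeff v ((Q : PowerSeries ℂ) * a) =
        PowerSeries.coeff v (P : PowerSeries ℂ) := by simp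
  rw [e, key, key]
  constructor
  · rintro ⟨c, hcc⟩
    refine ⟨-c * (Q : PowerSeries ℂ), ?_⟩
    linear_combination (-(Q : PowerSeries ℂ)) * hcc + (P : PowerSeries ℂ) * hQ
  · rintro ⟨c, hcc⟩
    refine ⟨-c * (Q : PowerSeries ℂ)⁻¹, ?_⟩
    linear_combination (-(Q : PowerSeries ℂ)⁻¹) * hcc + a * hQ

/-- If the Hankel determinant is nonzero, there is exactly one Padé approximant. -/
theorem existsUnique_isPade (a : PowerSeries ℂ) (p q : ℕ) (h : HankelNonzero a p q) :
    ∃! R : RatFunc ℂ, IsPade a p q R := by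
  have hu : IsUnit (hankelMatrix a p q).det := isUnit_iff_ne_zero.mpr h
  obtain ⟨x, hx⟩ : ∃ x : Fin q → ℂ, (hankelMatrix a p q).mulVec x =
      fun i : Fin q => -PowerSeries.coeff (p + 1 + (i : ℕ)) a :=
    ⟨(hankelMatrix a p q)⁻¹.mulVec _, by
      rw [Matrix.mulVec_mulVec, Matrix.mul_nonsing_inv _ hu, Matrix.one_mulVec]⟩
  -- the denominator satisfies the linear system exactly when it is given by `x`
  have sys : ∀ P Q : ℂ[X], P.natDegree ≤ p → Q.natDegree ≤ q → Q.coeff 0 = 1 →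
      ((∀ v ≤ p + q, PowerSeries.coeff v ((Q : PowerSeries ℂ) * a) = P.coeff v) ↔
        (∀ j : Fin q, Q.coeff (q - j) = x j) ∧
          ∀ v ≤ p, PowerSeries.coeff v ((Q : PowerSeries ℂ) * a) = P.coeff v) := by
    intro P Q hP hQ h0
    constructor
    · intro hv
      refine ⟨?_, fun v hvp => hv v (by omega)⟩
      have : (hankelMatrix a p q).mulVec (fun j => Q.coeff (q - j)) =
          (hankelMatrix a p q).mulVec x := by
        rw [hx]
        funext i
        have h1 := coeff_mul_hankel a p q Q hQ h0 i
        rw [hv _ (by omega), Polynomial.coeff_eq_zero_of_natDegree_lt (by omega)] at h1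
        linear_combination -h1
      have := Matrix.mulVec_injective_of_isUnit ((Matrix.isUnit_iff_isUnit_det _).mpr hu) this
      exact fun j => congrFun this j
    · rintro ⟨hj, hv⟩ v hvp
      rcases le_or_gt v p with hp | hp
      · exact hv v hp
      · obtain ⟨i, rfl⟩ : ∃ i : Fin q, v = p + 1 + i := ⟨⟨v - p - 1, by omega⟩, by simp; omega⟩
        rw [coeff_mul_hankel a p q Q hQ h0 i, Polynomial.coeff_eq_zero_of_natDegree_lt (by omega)]
        have : (fun j : Fin q => Q.coeff (q - j)) = x := funext hj
        rw [this, hx]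
        ring
  -- existence
  let Q : ℂ[X] := ∑ k ∈ Finset.range (q + 1),
    Polynomial.monomial k (if hk : 0 < k ∧ k ≤ q then x ⟨q - k, by omega⟩ else 1)
  have hQc : ∀ k, Q.coeff k = if k ≤ q then
      (if hk : 0 < k ∧ k ≤ q then x ⟨q - k, by omega⟩ else 1) else 0 := by
    intro k
    simp [Q, Polynomial.finsetSum_coeff, Polynomial.coeff_monomial]
  have hQ0 : Q.coeff 0 = 1 := by rw [hQc]; simp
  have hQd : Q.natDegree ≤ q := by
    rw [Polynomial.natDegree_le_iff_coeff_eq_zero]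
    intro k hk
    rw [hQc, if_neg (by omega)]
  have hQx : ∀ j : Fin q, Q.coeff (q - j) = x j := by
    intro j
    have := j.2
    rw [hQc, if_pos (by omega), dif_pos (by omega)]
    congr 1
    ext
    simp only
    omega
  let P : ℂ[X] := PowerSeries.trunc (p + 1) ((Q : PowerSeries ℂ) * a)
  have hPd : P.natDegree ≤ p := Nat.lt_succ_iff.mp (PowerSeries.natDegree_trunc_lt _ p)
  have hPc : ∀ v ≤ p, PowerSeries.coeff v ((Q : PowerSeries ℂ) * a) = P.coeff v := by
    intro v hv
    simp only [P]
    rw [PowerSeries.coeff_trunc, if_pos (by omega)]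
  refine ⟨_, ⟨P, Q, hPd, hQd, hQ0, rfl,
    (agree_iff a p q P Q hQ0).mpr ((sys P Q hPd hQd hQ0).mpr ⟨hQx, hPc⟩)⟩, ?_⟩
  -- uniqueness
  rintro R ⟨P', Q', hP', hQ', h0', rfl, hag⟩
  rw [agree_iff a p q P' Q' h0', sys P' Q' hP' hQ' h0'] at hag
  have hQQ : Q' = Q := by
    ext k
    rcases Nat.eq_zero_or_pos k with rfl | hk
    · rw [h0', hQ0]
    · rcases le_or_gt k q with hkq | hkq
      · have h1 := hag.1 ⟨q - k, by omega⟩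
        have h2 := hQx ⟨q - k, by omega⟩
        simp only [Nat.sub_sub_self hkq] at h1 h2
        rw [h1, h2]
      · rw [Polynomial.coeff_eq_zero_of_natDegree_lt (by omega),
          Polynomial.coeff_eq_zero_of_natDegree_lt (by omega)]
  have hPP : P' = P := by
    ext v
    rcases le_or_gt v p with hv | hv
    · rw [← hag.2 v hv, ← hPc v hv, hQQ]
    · rw [Polynomial.coeff_eq_zero_of_natDegree_lt (by omega),
        Polynomial.coeff_eq_zero_of_natDegree_lt (by omega)]
  rw [hQQ, hPP]

open Classical in
/-- The Padé approximant `[p/q]` of the formal series `a`, a rational function of the local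
variable `w = z - ζ`. It is the unique one when the Hankel determinant is nonzero, which is the
only case in which it is used; it is set to `0` when there is none. -/
def pade (a : PowerSeries ℂ) (p q : ℕ) : RatFunc ℂ :=
  if h : ∃ R, IsPade a p q R then h.choose else 0

theorem isPade_iff (a : PowerSeries ℂ) (p q : ℕ) (h : HankelNonzero a p q) (R : RatFunc ℂ) :
    IsPade a p q R ↔ R = pade a p q := by
  have hex := (existsUnique_isPade a p q h).exists
  have hp : IsPade a p q (pade a p q) := by
    rw [pade, dif_pos hex]
    exact hex.choose_spec
  exact ⟨fun hR => (existsUnique_isPade a p q h).unique hR hp, fun hR => hR ▸ hp⟩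

/-! ### Holomorphic functions on an open set -/

/-- Extension by zero of a function on `Ω`; only its values on `Ω` matter. -/
def extZero {Ω : Set ℂ} (f : Ω → ℂ) : ℂ → ℂ :=
  Function.extend Subtype.val f 0

/-- The space `H(Ω)` of holomorphic functions on the open set `Ω`. Its topology is induced from the
compact-open topology of `C(Ω, ℂ)`, that is, uniform convergence on the compact subsets of `Ω`. -/
abbrev Hol (Ω : Set ℂ) : Type :=
  {f : C(Ω, ℂ) // DifferentiableOn ℂ (extZero f) Ω}

/-- The Taylor series of `f` at the point `ζ`, as a formal series in `w = z - ζ`. -/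
def taylorSeries {Ω : Set ℂ} (f : Hol Ω) (ζ : ℂ) : PowerSeries ℂ :=
  PowerSeries.mk fun v => iteratedDeriv v (extZero f.1) ζ / (v.factorial : ℂ)

/-- `f ∈ 𝒟_{p,q}(ζ)`. -/
def MemD {Ω : Set ℂ} (f : Hol Ω) (ζ : ℂ) (p q : ℕ) : Prop :=
  HankelNonzero (taylorSeries f ζ) p q

/-- `z` is a pole of `[p/q]_{f,ζ}`: a zero of the denominator of the fraction in lowest terms. -/
def IsPadePole {Ω : Set ℂ} (f : Hol Ω) (ζ : ℂ) (p q : ℕ) (z : ℂ) : Prop :=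
  (pade (taylorSeries f ζ) p q).denom.eval (z - ζ) = 0

/-- The value `[p/q]_{f,ζ}(z)` (meaningful when `z` is not a pole). -/
def padeValue {Ω : Set ℂ} (f : Hol Ω) (ζ : ℂ) (p q : ℕ) (z : ℂ) : ℂ :=
  (pade (taylorSeries f ζ) p q).eval (RingHom.id ℂ) (z - ζ)

/-- The functions `f ∈ H(Ω)` for which some sequence `(p_n, q_n)` in `F` satisfies
`f ∈ 𝒟_{p_n,q_n}(ζ)` for all `n` and, for every compact `K ⊆ Ω`,
`sup_{z ∈ K} |[p_n/q_n]_{f,ζ}(z) - f(z)| → 0`. The supremum is `∞` when there is a pole in `K`, so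
that its convergence to zero includes the absence of poles in `K` for all large `n`. -/
def universalSet (Ω : Set ℂ) (F : Set (ℕ × ℕ)) (ζ : ℂ) : Set (Hol Ω) :=
  {f | ∃ s : ℕ → ℕ × ℕ, (∀ n, s n ∈ F) ∧ (∀ n, MemD f ζ (s n).1 (s n).2) ∧
    ∀ K : Set ℂ, IsCompact K → K ⊆ Ω →
      (∀ᶠ n in atTop, ∀ z ∈ K, ¬ IsPadePole f ζ (s n).1 (s n).2 z) ∧
      TendstoUniformlyOn (fun n => padeValue f ζ (s n).1 (s n).2) (extZero f.1) atTop K}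

end PadeGeneric

end

open Filter Topology Polynomial

noncomputable section

namespace PadeGeneric

/-! The theorem is a Baire category argument. For fixed `(p, q)` and `m`, the functions in
`𝒟_{p,q}(ζ)` whose `[p/q]` approximant has no pole on the `m`-th set of a compact exhaustion of `Ω`
and is `1/(m+1)`-close to them there form an open set (`isOpen_approxSet`), because numerator and
denominator, scaled by the Hankel determinant, depend continuously on `f`. The required set is the
intersection over `m` of the unions of these sets over `F` (`universalSet_eq_iInter`), and `H(Ω)` is
a Baire space, so only the density of each union is needed.

For density, Runge's theorem (`exists_rational_approx`, proved here from the Cauchy–Pompeiu formula)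
supplies near a given function a fraction `A / B` in lowest terms without poles in `Ω`. Choose `(p,
q)` in `F` with `deg A ≤ p` and `deg B < q`. The Hankel determinant of `A / B` may vanish, so, with
`w = z - ζ` and `r = q - deg B`, it is perturbed to `A / (B (1 + δ w ^ r))`: for small `δ ≠ 0` this
is in lowest terms with denominator of exact degree `q`, which forces a nonzero determinant
(`hankelNonzero_of_isCoprime`). The perturbed fraction may have poles in `Ω`; replacing `1 / (1 + δ
w ^ r)` by a partial geometric sum gives a function in `H(Ω)` with the same Taylor coefficients up
to order `p + q`, so its approximant is that fraction. For small `δ` both are close to `A / B` on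
the compact set (`exists_mem_approxSet_near_rational`). -/

/-! ### The Cauchy–Pompeiu formula and Runge's theorem -/

open MeasureTheory in
/-- The **Cauchy–Pompeiu formula** for a compactly supported `C¹` function. -/
theorem integral_dbar_div_sub {u : ℂ → ℂ} (hu : ContDiff ℝ 1 u) (hc : HasCompactSupport u)
    (z : ℂ) :
    ∫ ζ, (fderiv ℝ u ζ 1 + Complex.I * fderiv ℝ u ζ Complex.I) / (ζ - z) =
      -(2 * Real.pi) * u z := by
  have hcont : Continuous (fderiv ℝ u) := hu.continuous_fderiv one_ne_zero
  set e : ℝ → ℂ := fun θ => Complex.exp (θ * Complex.I) with he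
  have hec : Continuous e := by fun_prop
  have hed : ∀ θ, HasDerivAt e (e θ * Complex.I) θ := by
    intro θ
    have h := ((Complex.ofRealCLM.hasDerivAt (x := θ)).mul_const Complex.I).cexp
    simpa [he] using h
  have hen : ∀ θ, ‖e θ‖ = 1 := fun θ => Complex.norm_exp_ofReal_mul_I θ
  have he0 : ∀ θ, e θ ≠ 0 := fun θ => Complex.exp_ne_zero _
  -- In polar coordinates about `z`, `A` is the radial derivative of `u` and `r * B` the angular
  -- one. The integrand times the Jacobian `r` becomes `A + I * B`, with no singularity; `A`
  -- integrates to `-u z` along each ray and `B` to zero around each circle.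
  set A : ℝ × ℝ → ℂ := fun p => fderiv ℝ u (z + p.1 * e p.2) (e p.2) with hA
  set B : ℝ × ℝ → ℂ := fun p => fderiv ℝ u (z + p.1 * e p.2) (e p.2 * Complex.I) with hB
  have hAc : Continuous A := by
    refine (hcont.comp ?_).clm_apply ?_ <;> fun_prop
  have hBc : Continuous B := by
    refine (hcont.comp ?_).clm_apply ?_ <;> fun_prop
  obtain ⟨R, hR0, hR⟩ : ∃ R : ℝ, 0 < R ∧ tsupport u ⊆ Metric.ball z R := by
    obtain ⟨R, hR⟩ := hc.isCompact.isBounded.subset_ball z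
    exact ⟨max R 1, by positivity, hR.trans (Metric.ball_subset_ball (le_max_left _ _))⟩
  have hu0 : ∀ r θ : ℝ, R ≤ r → u (z + r * e θ) = 0 ∧ fderiv ℝ u (z + r * e θ) = 0 := by
    intro r θ hr
    have hn : z + r * e θ ∉ tsupport u := by
      intro h
      have := hR h
      simp only [Metric.mem_ball, dist_eq_norm, add_sub_cancel_left, norm_mul, hen,
        Complex.norm_real, mul_one, Real.norm_eq_abs, abs_of_nonneg (hR0.le.trans hr)] at this
      linarith
    exact ⟨image_eq_zero_of_notMem_tsupport hn,
      image_eq_zero_of_notMem_tsupport fun h => hn (tsupport_fderiv_subset ℝ h)⟩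
  have hAd : ∀ r θ : ℝ, HasDerivAt (fun r : ℝ => u (z + r * e θ)) (A (r, θ)) r := by
    intro r θ
    have h1 : HasDerivAt (fun r : ℝ => z + r * e θ) (e θ) r := by
      simpa using ((Complex.ofRealCLM.hasDerivAt (x := r)).mul_const (e θ)).const_add z
    exact ((hu.differentiable one_ne_zero).differentiableAt.hasFDerivAt).comp_hasDerivAt r h1
  have hBd : ∀ r θ : ℝ, HasDerivAt (fun θ : ℝ => u (z + r * e θ)) (r * B (r, θ)) θ := by
    intro r θ
    have h1 : HasDerivAt (fun θ : ℝ => z + r * e θ) (r • (e θ * Complex.I)) θ := by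
      simpa using ((hed θ).const_mul (r : ℂ)).const_add z
    have := ((hu.differentiable one_ne_zero).differentiableAt.hasFDerivAt).comp_hasDerivAt θ h1
    rw [← Complex.real_smul, hB]
    simpa only [map_smul] using! this
  have hpi : -Real.pi ≤ Real.pi := by linarith [Real.pi_pos]
  have hint : ∀ G : ℝ × ℝ → ℂ, Continuous G →
      Integrable G ((volume.restrict (Set.Ioc 0 R)).prod
        (volume.restrict (Set.Ioc (-Real.pi) Real.pi))) := by
    intro G hG
    rw [Measure.prod_restrict]
    exact (hG.continuousOn.integrableOn_compact (isCompact_Icc.prod isCompact_Icc)).mono_set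
      (Set.prod_mono Set.Ioc_subset_Icc_self Set.Ioc_subset_Icc_self)
  have hAi : ∫ p, A p ∂((volume.restrict (Set.Ioc 0 R)).prod
        (volume.restrict (Set.Ioc (-Real.pi) Real.pi))) = -(2 * Real.pi) * u z := by
    rw [integral_prod_symm _ (hint A hAc)]
    have : ∀ θ : ℝ, ∫ r in Set.Ioc 0 R, A (r, θ) = -u z := by
      intro θ
      rw [← intervalIntegral.integral_of_le hR0.le,
        intervalIntegral.integral_eq_sub_of_hasDerivAt (fun r _ => hAd r θ)
          ((by fun_prop : Continuous fun r => A (r, θ)).intervalIntegrable _ _), (hu0 R θ le_rfl).1]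
      simp
    simp only [this]
    rw [integral_const, measureReal_restrict_apply_univ, Real.volume_real_Ioc_of_le hpi,
      Complex.real_smul]
    push_cast
    ring
  have hBi : ∫ p, B p ∂((volume.restrict (Set.Ioc 0 R)).prod
        (volume.restrict (Set.Ioc (-Real.pi) Real.pi))) = 0 := by
    rw [integral_prod _ (hint B hBc)]
    rw [setIntegral_congr_fun (g := fun _ => 0) measurableSet_Ioc, integral_zero]
    intro r hr
    have hr0 : (r : ℂ) ≠ 0 := by exact_mod_cast hr.1.ne'
    have h1 : ∫ θ in (-Real.pi)..Real.pi, (r * B (r, θ)) = 0 := by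
      rw [intervalIntegral.integral_eq_sub_of_hasDerivAt (fun θ _ => hBd r θ)
        ((by fun_prop : Continuous fun θ => r * B (r, θ)).intervalIntegrable _ _)]
      have : e Real.pi = e (-Real.pi) := by simp [he, Complex.exp_neg]
      rw [this, sub_self]
    rw [intervalIntegral.integral_const_mul, mul_eq_zero, intervalIntegral.integral_of_le hpi] at h1
    exact h1.resolve_left hr0
  calc ∫ ζ, (fderiv ℝ u ζ 1 + Complex.I * fderiv ℝ u ζ Complex.I) / (ζ - z)
      = ∫ ζ, (fderiv ℝ u (z + ζ) 1 + Complex.I * fderiv ℝ u (z + ζ) Complex.I) / ζ := by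
        rw [← integral_add_left_eq_self _ z]
        simp
    _ = ∫ p in polarCoord.target, (A p + Complex.I * B p) := by
        rw [← Complex.integral_comp_polarCoord_symm]
        refine setIntegral_congr_fun (polarCoord.open_target.measurableSet) ?_
        rintro ⟨r, θ⟩ ⟨hr, -⟩
        have hr0 : (r : ℂ) ≠ 0 := by
          simp only [Set.mem_Ioi] at hr
          exact_mod_cast hr.ne'
        have hexp : Complex.polarCoord.symm (r, θ) = r * e θ := by
          simp [he, Complex.exp_mul_I]
        -- For `w = e θ` the conjugate is the inverse, so this factor is exactly what remains of `1
        -- / (r * e θ)` after multiplication by `r`.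
        have key : ∀ (L : ℂ →L[ℝ] ℂ) (w : ℂ),
            L w + Complex.I * L (w * Complex.I) = (starRingEnd ℂ) w * (L 1 + Complex.I * L Complex.I) := by
          intro L w
          have hw : w = w.re • (1 : ℂ) + w.im • Complex.I := by
            simp [Complex.re_add_im]
          have hw2 : w * Complex.I = w.re • Complex.I + (-w.im) • (1 : ℂ) := by
            apply Complex.ext <;> simp
          have h1 : L w = w.re * L 1 + w.im * L Complex.I := by
            conv_lhs => rw [hw]
            rw [map_add, map_smul, map_smul]
            simp only [Complex.real_smul]
          have h2 : L (w * Complex.I) = w.re * L Complex.I - w.im * L 1 := by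
            rw [hw2]
            rw [map_add, map_smul, map_smul]
            simp only [Complex.real_smul]
            push_cast
            ring
          have h3 : (starRingEnd ℂ) w = w.re - w.im * Complex.I := by
            apply Complex.ext <;> simp
          rw [h1, h2, h3]
          linear_combination (w.im * L Complex.I) * Complex.I_sq
        have hconj : (starRingEnd ℂ) (e θ) = (e θ)⁻¹ := by
          rw [Complex.inv_def, Complex.normSq_eq_norm_sq, hen]
          simp
        simp only [hexp, hA, hB, key, hconj, Complex.real_smul]
        field_simp [he0 θ]
    _ = ∫ p in Set.Ioc 0 R ×ˢ Set.Ioc (-Real.pi) Real.pi, (A p + Complex.I * B p) := by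
        rw [show polarCoord.target = Set.Ioi (0 : ℝ) ×ˢ Set.Ioo (-Real.pi) Real.pi from rfl]
        have h1 : ∫ p in Set.Ioi (0 : ℝ) ×ˢ Set.Ioo (-Real.pi) Real.pi, (A p + Complex.I * B p) =
            ∫ p in Set.Ioc (0 : ℝ) R ×ˢ Set.Ioo (-Real.pi) Real.pi, (A p + Complex.I * B p) := by
          refine setIntegral_eq_of_subset_of_forall_sdiff_eq_zero
            (measurableSet_Ioi.prod measurableSet_Ioo)
            (Set.prod_mono Set.Ioc_subset_Ioi_self le_rfl) ?_
          rintro ⟨r, θ⟩ ⟨⟨hr, hθ⟩, hn⟩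
          have hr' : R ≤ r := by
            by_contra! h
            exact hn ⟨⟨hr, h.le⟩, hθ⟩
          simp [hA, hB, (hu0 r θ hr').2]
        rw [h1]
        refine setIntegral_congr_set ?_
        exact Measure.set_prod_ae_eq (ae_eq_refl _) Ioo_ae_eq_Ioc
    _ = _ := by
        rw [Measure.volume_eq_prod, ← Measure.prod_restrict,
          integral_add (hint A hAc) ((hint B hBc).const_mul _), integral_const_mul, hAi, hBi]
        simp

open Manifold in
/-- A holomorphic function on `Ω` is, on a compact subset `K`, a superposition of Cauchy kernels
with poles off `K`. -/
theorem exists_cauchy_representation {Ω K : Set ℂ} (hΩ : IsOpen Ω) (hK : IsCompact K)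
    (hKΩ : K ⊆ Ω) {f : ℂ → ℂ} (hf : DifferentiableOn ℂ f Ω) :
    ∃ g : ℂ → ℂ, Continuous g ∧ HasCompactSupport g ∧ Disjoint (tsupport g) K ∧
      ∀ z ∈ K, f z = ∫ ζ, g ζ / (ζ - z) := by
  obtain ⟨K', hK', hKK', hK'Ω⟩ := exists_compact_between hK hΩ hKΩ
  obtain ⟨φ, hφ1, hφ0, -⟩ := exists_contMDiffMap_one_nhds_of_subset_interior
    (n := 1) 𝓘(ℝ, ℂ) hK.isClosed hKK'
  have hφ : ContDiff ℝ 1 φ := by simpa using φ.contMDiff.contDiff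
  have hsupp : Function.support (fun z => (φ z : ℂ) * f z) ⊆ K' := by
    intro z hz
    by_contra h
    exact hz (by simp [hφ0 z h])
  have hts : tsupport (fun z => (φ z : ℂ) * f z) ⊆ K' :=
    closure_minimal hsupp hK'.isClosed
  -- Nothing is known about `f` off `Ω`, but the cutoff `φ` makes the product vanish near every
  -- point outside `Ω`.
  have hu : ContDiff ℝ 1 (fun z => (φ z : ℂ) * f z) := by
    rw [contDiff_iff_contDiffAt]
    intro z
    by_cases hz : z ∈ Ω
    · have h1 : ContDiffAt ℝ 1 f z :=
        ((hf.contDiffOn hΩ).contDiffAt (hΩ.mem_nhds hz)).restrict_scalars ℝ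
      exact (Complex.ofRealCLM.contDiff.comp hφ).contDiffAt.mul h1
    · have : (fun z => (φ z : ℂ) * f z) =ᶠ[𝓝 z] fun _ => 0 :=
        notMem_tsupport_iff_eventuallyEq.mp fun h => hz (hK'Ω (hts h))
      exact contDiffAt_const.congr_of_eventuallyEq this
  have hc : HasCompactSupport (fun z => (φ z : ℂ) * f z) :=
    HasCompactSupport.of_support_subset_isCompact hK' hsupp
  set u : ℂ → ℂ := fun z => (φ z : ℂ) * f z with hudef
  have hDc : Continuous (fderiv ℝ u) := hu.continuous_fderiv one_ne_zero
  set D : ℂ → ℂ := fun ζ => fderiv ℝ u ζ 1 + Complex.I * fderiv ℝ u ζ Complex.I with hD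
  have hpi : (-(2 * Real.pi) : ℂ) ≠ 0 := by simp [Real.pi_ne_zero]
  refine ⟨fun ζ => (-(2 * Real.pi) : ℂ)⁻¹ * D ζ, by fun_prop, ?_, ?_, ?_⟩
  · refine HasCompactSupport.of_support_subset_isCompact hc.isCompact fun ζ hζ => ?_
    by_contra h
    have : fderiv ℝ u ζ = 0 :=
      image_eq_zero_of_notMem_tsupport fun h' => h (tsupport_fderiv_subset ℝ h')
    exact hζ (by simp [hD, this])
  · rw [Set.disjoint_right]
    intro z hz
    rw [notMem_tsupport_iff_eventuallyEq]
    have h1 : ∀ᶠ ζ in 𝓝 z, φ ζ = 1 := Filter.Eventually.filter_mono (nhds_le_nhdsSet hz) hφ1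
    filter_upwards [h1.eventually_nhds, hΩ.mem_nhds (hKΩ hz)] with ζ hζ hζΩ
    have h2 : u =ᶠ[𝓝 ζ] f := by
      filter_upwards [hζ] with w hw
      simp [hudef, hw]
    have h3 : fderiv ℝ u ζ = (fderiv ℂ f ζ).restrictScalars ℝ := by
      rw [h2.fderiv_eq]
      exact ((hf.differentiableAt (hΩ.mem_nhds hζΩ)).hasFDerivAt.restrictScalars ℝ).fderiv
    -- The Cauchy–Riemann equation: near `K`, where `φ = 1`, the function `u` is holomorphic, so its
    -- `∂̄`-derivative vanishes and `g` is supported off `K`.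
    have h4 : fderiv ℂ f ζ Complex.I = Complex.I * fderiv ℂ f ζ 1 := by
      simpa only [smul_eq_mul, mul_one] using (fderiv ℂ f ζ).map_smul Complex.I 1
    simp only [hD, h3, ContinuousLinearMap.coe_restrictScalars', h4, Pi.zero_apply]
    linear_combination ((-(2 * Real.pi) : ℂ)⁻¹ * fderiv ℂ f ζ 1) * Complex.I_sq
  · intro z hz
    have h1 : φ z = 1 := hφ1.self_of_nhdsSet z hz
    have := integral_dbar_div_sub hu hc z
    simp only [mul_div_assoc]
    rw [MeasureTheory.integral_const_mul, this, inv_mul_cancel_left₀ hpi]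
    simp [hudef, h1]

/-- The functions on `K` that are restrictions of rational functions without poles in `Ω`,
written in the local variable `z - ζ`. -/
def rationalSubalgebra (Ω K : Set ℂ) (ζ : ℂ) : Subalgebra ℂ C(K, ℂ) where
  carrier := {g | ∃ A B : ℂ[X], (∀ z ∈ Ω, B.eval (z - ζ) ≠ 0) ∧
    ∀ z : K, g z * B.eval ((z : ℂ) - ζ) = A.eval ((z : ℂ) - ζ)}
  mul_mem' := by
    rintro g₁ g₂ ⟨A₁, B₁, h₁, e₁⟩ ⟨A₂, B₂, h₂, e₂⟩
    refine ⟨A₁ * A₂, B₁ * B₂, fun z hz => ?_, fun z => ?_⟩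
    · rw [eval_mul]
      exact mul_ne_zero (h₁ z hz) (h₂ z hz)
    · rw [eval_mul, eval_mul, ← e₁, ← e₂, ContinuousMap.mul_apply]
      ring
  add_mem' := by
    rintro g₁ g₂ ⟨A₁, B₁, h₁, e₁⟩ ⟨A₂, B₂, h₂, e₂⟩
    refine ⟨A₁ * B₂ + A₂ * B₁, B₁ * B₂, fun z hz => ?_, fun z => ?_⟩
    · rw [eval_mul]
      exact mul_ne_zero (h₁ z hz) (h₂ z hz)
    · rw [eval_mul, eval_add, eval_mul, eval_mul, ← e₁, ← e₂, ContinuousMap.add_apply]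
      ring
  algebraMap_mem' c := ⟨C c, 1, fun z _ => by simp, fun z => by simp⟩

/-- The inverse is the Neumann series, whose partial sums lie in the subalgebra; closedness keeps
the limit there. -/
lemma exists_mem_mul_one_sub_eq_one {A : Type*} [NormedCommRing A] [NormedAlgebra ℂ A]
    [CompleteSpace A] (S : Subalgebra ℂ A) (hS : IsClosed (S : Set A)) {x : A} (hx : x ∈ S)
    (hn : ‖x‖ < 1) : ∃ y ∈ S, y * (1 - x) = 1 := by
  have hs := summable_geometric_of_norm_lt_one hn
  refine ⟨∑' n : ℕ, x ^ n, ?_, geom_series_mul_neg x hn⟩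
  exact hS.mem_of_tendsto hs.hasSum (Eventually.of_forall fun s => S.sum_mem fun i _ => S.pow_mem hx i)

/-- If `K` satisfies the hypothesis `hsep`, the Cauchy kernels with poles off `K` are uniform limits
on `K` of rational functions without poles in `Ω`. -/
lemma cauchyKernel_mem_closure {Ω K : Set ℂ} [CompactSpace K] (hKΩ : K ⊆ Ω) (ζ : ℂ)
    {a : ℂ} (hsep : (∀ z ∈ K, ‖z‖ < ‖a‖) ∨ ∃ w ∉ Ω, ∀ z ∈ K, ‖a - w‖ < ‖z - w‖)
    (g : C(K, ℂ)) (hg : ∀ z : K, g z * (a - z) = 1) :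
    g ∈ (rationalSubalgebra Ω K ζ).topologicalClosure := by
  have hle := (rationalSubalgebra Ω K ζ).le_topologicalClosure
  have hcl := (rationalSubalgebra Ω K ζ).isClosed_topologicalClosure
  set S := (rationalSubalgebra Ω K ζ).topologicalClosure
  rcases hsep with h | ⟨w, hw, h⟩
  -- Here `1 / (a - z) = a⁻¹ ∑ (z / a) ^ n`, a uniform limit of polynomials.
  · let x : C(K, ℂ) := ⟨fun z => a⁻¹ * z, by fun_prop⟩
    have hxS : x ∈ S := hle ⟨C a⁻¹ * (X + C ζ), 1, fun z _ => by simp, fun z => by simp [x]⟩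
    have hx1 : ‖x‖ < 1 := by
      rw [ContinuousMap.norm_lt_iff _ one_pos]
      intro z
      have ha : 0 < ‖a‖ := (norm_nonneg _).trans_lt (h z z.2)
      simp only [x, ContinuousMap.coe_mk, norm_mul, norm_inv]
      rw [inv_mul_lt_iff₀ ha, mul_one]
      exact h z z.2
    obtain ⟨y, hy, hyx⟩ := exists_mem_mul_one_sub_eq_one S hcl hxS hx1
    have : g = a⁻¹ • y := by
      ext z
      have e1 := congrArg (fun F : C(K, ℂ) => F z) hyx
      have e2 := hg z
      have ha : a ≠ 0 := norm_pos_iff.mp ((norm_nonneg _).trans_lt (h z z.2))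
      have haz : a - z ≠ 0 := right_ne_zero_of_mul_eq_one e2
      simp only [x, ContinuousMap.mul_apply, ContinuousMap.sub_apply, ContinuousMap.one_apply,
        ContinuousMap.coe_mk] at e1
      simp only [ContinuousMap.smul_apply, smul_eq_mul]
      field_simp at e1
      apply mul_right_cancel₀ haz
      rw [e2, mul_assoc, inv_mul_eq_div, eq_div_iff ha, e1, one_mul]
    rw [this]
    exact S.smul_mem hy _
  -- With `v = 1 / (z - w)`, the kernel is `-v / (1 - (a - w) v)`; `v` has its only pole at `w ∉ Ω`.
  · have hne : ∀ z ∈ K, z - w ≠ 0 := fun z hz h0 => hw (by rw [← sub_eq_zero.mp h0]; exact hKΩ hz)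
    let v : C(K, ℂ) := ⟨fun z => (z - w)⁻¹,
      (by fun_prop : Continuous fun z : K => (z : ℂ) - w).inv₀ fun z => hne z z.2⟩
    have hvS : v ∈ S := hle ⟨1, X + C (ζ - w), fun z hz => by
        simp only [eval_add, eval_X, eval_C]
        intro h0
        apply hw
        rwa [← sub_eq_zero.mp (show z - w = 0 by linear_combination h0)], fun z => by
        have := hne z z.2
        simp only [v, ContinuousMap.coe_mk, eval_add, eval_X, eval_C, eval_one]
        rw [show (z : ℂ) - ζ + (ζ - w) = z - w by ring, inv_mul_cancel₀ this]⟩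
    have hx1 : ‖(a - w) • v‖ < 1 := by
      rw [ContinuousMap.norm_lt_iff _ one_pos]
      intro z
      have : 0 < ‖(z : ℂ) - w‖ := norm_pos_iff.mpr (hne z z.2)
      simp only [v, ContinuousMap.smul_apply, ContinuousMap.coe_mk, smul_eq_mul, norm_mul, norm_inv]
      rw [mul_inv_lt_iff₀ this, one_mul]
      exact h z z.2
    obtain ⟨y, hy, hyx⟩ := exists_mem_mul_one_sub_eq_one S hcl (S.smul_mem hvS (a - w)) hx1
    have : g = -(v * y) := by
      ext z
      have e1 := congrArg (fun F : C(K, ℂ) => F z) hyx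
      have e2 := hg z
      have e3 := hne z z.2
      have haz : a - z ≠ 0 := right_ne_zero_of_mul_eq_one e2
      simp only [v, ContinuousMap.mul_apply, ContinuousMap.sub_apply, ContinuousMap.one_apply,
        ContinuousMap.coe_mk, ContinuousMap.smul_apply, smul_eq_mul, ContinuousMap.neg_apply] at e1 ⊢
      field_simp at e1
      apply mul_right_cancel₀ haz
      rw [e2, ← mul_right_inj' e3]
      field_simp
      linear_combination -e1
    rw [this]
    exact S.neg_mem (S.mul_mem hvS hy)

open MeasureTheory in
/-- **Runge's theorem** for compact sets `K` satisfying the explicit separation hypothesis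
`hsep`. -/
theorem exists_rational_approx {Ω K : Set ℂ} (hΩ : IsOpen Ω) (hK : IsCompact K)
    (hKΩ : K ⊆ Ω)
    (hsep : ∀ a ∉ K, (∀ z ∈ K, ‖z‖ < ‖a‖) ∨ ∃ w ∉ Ω, ∀ z ∈ K, ‖a - w‖ < ‖z - w‖)
    (ζ : ℂ) {f : ℂ → ℂ} (hf : DifferentiableOn ℂ f Ω) {ε : ℝ} (hε : 0 < ε) :
    ∃ A B : ℂ[X], (∀ z ∈ Ω, B.eval (z - ζ) ≠ 0) ∧
      ∀ z ∈ K, ‖A.eval (z - ζ) / B.eval (z - ζ) - f z‖ < ε := by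
  have : CompactSpace K := isCompact_iff_compactSpace.mp hK
  obtain ⟨g, hgc, hgs, hgd, hgf⟩ := exists_cauchy_representation hΩ hK hKΩ hf
  have hG : Continuous fun p : ℂ × K => g p.1 / (p.1 - p.2) := by
    rw [continuous_iff_continuousAt]
    rintro ⟨a, z⟩
    by_cases ha : a ∈ tsupport g
    · refine ContinuousAt.div (by fun_prop) (by fun_prop) ?_
      intro h
      exact Set.disjoint_left.mp hgd ha (by
        rw [show a = z from sub_eq_zero.mp h]
        exact z.2)
    · have h0 : ∀ᶠ p : ℂ × K in 𝓝 (a, z), g p.1 = 0 :=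
        (continuous_fst.tendsto (a, z)).eventually (notMem_tsupport_iff_eventuallyEq.mp ha)
      refine (continuousAt_const (y := (0 : ℂ))).congr ?_
      filter_upwards [h0] with p hp
      simp [hp]
  -- The Cauchy integral is read as a Bochner integral with values in `C(K, ℂ)`, so that it lies in
  -- any closed subspace containing the integrand.
  let Φ : C(ℂ, C(K, ℂ)) := ContinuousMap.curry ⟨_, hG⟩
  have hΦs : HasCompactSupport Φ := by
    refine HasCompactSupport.of_support_subset_isCompact hgs.isCompact fun a ha => ?_
    by_contra h
    refine ha ?_
    ext z
    simp [Φ, image_eq_zero_of_notMem_tsupport h]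
  have hΦi : Integrable Φ := Φ.continuous.integrable_of_hasCompactSupport hΦs
  set S := (rationalSubalgebra Ω K ζ).topologicalClosure with hS
  have hΦS : ∀ a, Φ a ∈ S := by
    intro a
    by_cases ha : a ∈ tsupport g
    · have haK : a ∉ K := Set.disjoint_left.mp hgd ha
      have hne : ∀ z : K, a - z ≠ 0 := fun z h => haK (by rw [sub_eq_zero.mp h]; exact z.2)
      let k : C(K, ℂ) := ⟨fun z => (a - z)⁻¹,
        (by fun_prop : Continuous fun z : K => a - (z : ℂ)).inv₀ hne⟩
      have hk : k ∈ S := cauchyKernel_mem_closure hKΩ ζ (hsep a haK) k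
        fun z => inv_mul_cancel₀ (hne z)
      have : Φ a = g a • k := by
        ext z
        simp [Φ, k, div_eq_mul_inv]
      rw [this]
      exact S.smul_mem hk _
    · have : Φ a = 0 := by
        ext z
        simp [Φ, image_eq_zero_of_notMem_tsupport ha]
      rw [this]
      exact S.zero_mem
  have hIS : ∫ a, Φ a ∈ S := by
    have : IsClosed (S.toSubmodule : Set C(K, ℂ)) :=
      (rationalSubalgebra Ω K ζ).isClosed_topologicalClosure
    -- The quotient map by the closed subspace commutes with the integral and kills the integrand.
    have h1 : S.toSubmodule.mkQL (∫ a, Φ a) = 0 := by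
      rw [← ContinuousLinearMap.integral_comp_comm _ hΦi]
      have : ∀ a, S.toSubmodule.mkQL (Φ a) = 0 := fun a =>
        (Submodule.Quotient.mk_eq_zero _).mpr (hΦS a)
      simp [this]
    exact (Submodule.Quotient.mk_eq_zero _).mp h1
  have hIf : ∀ z : K, (∫ a, Φ a) z = f z := by
    intro z
    have := ContinuousLinearMap.integral_comp_comm (ContinuousMap.evalCLM ℂ z) hΦi
    simp only [ContinuousMap.evalCLM_apply] at this
    rw [← this, hgf z z.2]
    rfl
  obtain ⟨h, ⟨A, B, hB, hAB⟩, hlt⟩ := Metric.mem_closure_iff.mp hIS ε hε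
  refine ⟨A, B, hB, fun z hz => ?_⟩
  rw [← hAB ⟨z, hz⟩, mul_div_cancel_right₀ _ (hB z (hKΩ hz)), ← hIf ⟨z, hz⟩, ← dist_eq_norm]
  rw [dist_comm]
  exact (ContinuousMap.dist_apply_le_dist _).trans_lt hlt

/-! ### Hankel determinants and coprimality -/

lemma coeff_mul_eq_hankel_mulVec (a : PowerSeries ℂ) (p q : ℕ) (Q : ℂ[X]) (hQ : Q.natDegree ≤ q)
    (h0 : Q.coeff 0 = 0) (i : Fin q) :
    PowerSeries.coeff (p + 1 + i) ((Q : PowerSeries ℂ) * a) =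
      (hankelMatrix a p q).mulVec (fun j => Q.coeff (q - j)) i := by
  have hd : (Q + 1).natDegree ≤ q := (natDegree_add_le _ _).trans (by simp [hQ])
  have h1 := coeff_mul_hankel a p q (Q + 1) hd (by simp [h0]) i
  have h2 : (fun j : Fin q => (Q + 1).coeff (q - j)) = fun j : Fin q => Q.coeff (q - j) := by
    funext j
    rw [coeff_add, coeff_one, if_neg (by omega), add_zero]
  rw [h2, Polynomial.coe_add, Polynomial.coe_one, add_mul, one_mul, map_add] at h1
  linear_combination h1

/-- The coefficients of such a `Q` form a kernel vector of the Hankel matrix. -/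
lemma eq_zero_of_hankelNonzero {a : PowerSeries ℂ} {p q : ℕ} (h : HankelNonzero a p q) {Q : ℂ[X]}
    (hQ : Q.natDegree ≤ q) (h0 : Q.coeff 0 = 0)
    (hv : ∀ v, p < v → v ≤ p + q → PowerSeries.coeff v ((Q : PowerSeries ℂ) * a) = 0) :
    Q = 0 := by
  have h1 : (hankelMatrix a p q).mulVec (fun j : Fin q => Q.coeff (q - j)) = 0 := by
    funext i
    rw [← coeff_mul_eq_hankel_mulVec a p q Q hQ h0 i, hv _ (by omega) (by omega), Pi.zero_apply]
  have h2 := Matrix.eq_zero_of_mulVec_eq_zero h h1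
  ext k
  rcases Nat.eq_zero_or_pos k with rfl | hk
  · simpa using h0
  · rcases le_or_gt k q with hkq | hkq
    · have := congrFun h2 ⟨q - k, by omega⟩
      simpa only [Nat.sub_sub_self hkq] using! this
    · rw [coeff_eq_zero_of_natDegree_lt (by omega), coeff_zero]

/-- The polynomial of degree at most `q` without constant term whose coefficients, in decreasing
order of degree, are `x`. -/
def revPoly {q : ℕ} (x : Fin q → ℂ) : ℂ[X] :=
  ∑ j : Fin q, monomial (q - j) (x j)

lemma natDegree_revPoly_le {q : ℕ} (x : Fin q → ℂ) : (revPoly x).natDegree ≤ q :=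
  natDegree_sum_le_of_forall_le _ _ fun _ _ => (natDegree_monomial_le _).trans (by omega)

lemma coeff_zero_revPoly {q : ℕ} (x : Fin q → ℂ) : (revPoly x).coeff 0 = 0 := by
  rw [revPoly, finsetSum_coeff]
  exact Finset.sum_eq_zero fun j _ => by rw [coeff_monomial, if_neg (by omega)]

lemma coeff_revPoly {q : ℕ} (x : Fin q → ℂ) (j : Fin q) : (revPoly x).coeff (q - j) = x j := by
  rw [revPoly, finsetSum_coeff, Finset.sum_eq_single j]
  · rw [coeff_monomial, if_pos rfl]
  · intro i _ hi
    rw [coeff_monomial, if_neg]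
    have := Fin.val_ne_of_ne hi
    omega
  · simp

lemma X_pow_dvd_mul_sub_trunc {a : PowerSeries ℂ} {p q : ℕ} {Q : ℂ[X]}
    (hv : ∀ i : Fin q, PowerSeries.coeff (p + 1 + i) ((Q : PowerSeries ℂ) * a) = 0) :
    PowerSeries.X ^ (p + q + 1) ∣ (Q : PowerSeries ℂ) * a -
      ((PowerSeries.trunc (p + 1) ((Q : PowerSeries ℂ) * a) : ℂ[X]) : PowerSeries ℂ) := by
  rw [PowerSeries.X_pow_dvd_iff]
  intro v hvp
  rw [map_sub, Polynomial.coeff_coe, PowerSeries.coeff_trunc]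
  split_ifs with h
  · rw [sub_self]
  · have := hv ⟨v - (p + 1), by omega⟩
    simp only [show p + 1 + (v - (p + 1)) = v by omega] at this
    rw [this, sub_zero]

lemma eq_zero_of_X_pow_dvd_coe {n : ℕ} {P : ℂ[X]} (hP : P.natDegree ≤ n)
    (h : PowerSeries.X ^ (n + 1) ∣ (P : PowerSeries ℂ)) : P = 0 := by
  rw [PowerSeries.X_pow_dvd_iff] at h
  ext k
  rcases le_or_gt k n with hk | hk
  · simpa using h k (by omega)
  · rw [coeff_eq_zero_of_natDegree_lt (by omega), coeff_zero]

/-- A fraction in lowest terms with denominator of exact degree `q` has a nonzero Hankel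
determinant. -/
theorem hankelNonzero_of_isCoprime {a : PowerSeries ℂ} {p q : ℕ} {P Q : ℂ[X]}
    (hP : P.natDegree ≤ p) (hQ : Q.natDegree = q) (h0 : Q.coeff 0 ≠ 0) (hco : IsCoprime P Q)
    (hd : PowerSeries.X ^ (p + q + 1) ∣ (Q : PowerSeries ℂ) * a - (P : PowerSeries ℂ)) :
    HankelNonzero a p q := by
  intro hdet
  obtain ⟨x, hx0, hx⟩ := Matrix.exists_mulVec_eq_zero_iff.mpr hdet
  apply hx0
  set Q' := revPoly x
  have hQ' : Q'.natDegree ≤ q := natDegree_revPoly_le x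
  have hc : (fun j : Fin q => Q'.coeff (q - j)) = x := funext (coeff_revPoly x)
  have hd' := X_pow_dvd_mul_sub_trunc (a := a) (p := p) (q := q) (Q := Q') fun i => by
    rw [coeff_mul_eq_hankel_mulVec a p q Q' hQ' (coeff_zero_revPoly x), hc, hx, Pi.zero_apply]
  set P' := PowerSeries.trunc (p + 1) ((Q' : PowerSeries ℂ) * a)
  have hP' : P'.natDegree ≤ p := Nat.lt_succ_iff.mp (PowerSeries.natDegree_trunc_lt _ p)
  -- Both pairs solve the same approximation problem, so the cross difference vanishes to order `p +
  -- q + 1`, while its degree is at most `p + q`.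
  have h1 : Q' * P - Q * P' = 0 := by
    refine eq_zero_of_X_pow_dvd_coe (n := p + q) ?_ ?_
    · refine (natDegree_sub_le _ _).trans (max_le ?_ ?_) <;>
        exact natDegree_mul_le.trans (by omega)
    · obtain ⟨c, hc⟩ := hd
      obtain ⟨c', hc'⟩ := hd'
      refine ⟨Q * c' - Q' * c, ?_⟩
      simp only [Polynomial.coe_sub, Polynomial.coe_mul]
      linear_combination (Q : PowerSeries ℂ) * hc' - (Q' : PowerSeries ℂ) * hc
  obtain ⟨c, hc2⟩ : Q ∣ Q' := hco.symm.dvd_of_dvd_mul_right ⟨P', by linear_combination h1⟩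
  have hQ0 : Q ≠ 0 := fun h => h0 (by simp [h])
  -- Since `Q` has full degree `q`, the cofactor is constant; since `Q'` vanishes at `0` and `Q`
  -- does not, it is zero.
  have hc0 : c = 0 := by
    by_contra hne
    have : c.natDegree = 0 := by
      have := natDegree_mul hQ0 hne
      rw [← hc2] at this
      omega
    rw [natDegree_eq_zero] at this
    obtain ⟨b, rfl⟩ := this
    have h2 := coeff_zero_revPoly x
    rw [show revPoly x = Q * C b from hc2, coeff_mul_C] at h2
    exact hne (by rw [(mul_eq_zero.mp h2).resolve_left h0, C_0])
  funext j
  rw [← coeff_revPoly x j, show revPoly x = Q * c from hc2, hc0, mul_zero, coeff_zero, Pi.zero_apply]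

lemma dvd_of_unit_mul_dvd {b : PowerSeries ℂ} {n : ℕ} {Q : ℂ[X]} (h0 : Q.coeff 0 ≠ 0)
    (h : PowerSeries.X ^ n ∣ (Q : PowerSeries ℂ) * b) : PowerSeries.X ^ n ∣ b := by
  have : IsUnit (Q : PowerSeries ℂ) := by
    rw [PowerSeries.isUnit_iff_constantCoeff]
    simpa using h0
  exact (this.dvd_mul_left).mp h

/-- When the Hankel determinant is nonzero, numerator and denominator of a Padé approximant have no
common factor. -/
theorem isCoprime_of_hankelNonzero {a : PowerSeries ℂ} {p q : ℕ} (h : HankelNonzero a p q)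
    {P Q : ℂ[X]} (hP : P.natDegree ≤ p) (hQ : Q.natDegree ≤ q) (h0 : Q.coeff 0 ≠ 0)
    (hd : PowerSeries.X ^ (p + q + 1) ∣ (Q : PowerSeries ℂ) * a - (P : PowerSeries ℂ)) : IsCoprime P Q := by
  by_contra hco
  rw [isCoprime_iff_aeval_ne_zero_of_isAlgClosed ℂ ℂ] at hco
  push Not at hco
  obtain ⟨α, hα1, hα2⟩ := hco
  rw [coe_aeval_eq_eval] at hα1 hα2
  obtain ⟨P₁, rfl⟩ := dvd_iff_isRoot.mpr hα1
  obtain ⟨Q₁, rfl⟩ := dvd_iff_isRoot.mpr hα2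
  have hQ₁0 : Q₁ ≠ 0 := by
    rintro rfl
    simp at h0
  have hα0 : (X - C α).coeff 0 ≠ 0 := by
    intro h'
    rw [mul_coeff_zero, h', zero_mul] at h0
    exact h0 rfl
  -- A common root `α` is nonzero, so `X - C α` is a unit among power series and can be cancelled
  -- without loss of order.
  have hd₁ : PowerSeries.X ^ (p + q + 1) ∣ (Q₁ : PowerSeries ℂ) * a - (P₁ : PowerSeries ℂ) := by
    refine dvd_of_unit_mul_dvd hα0 ?_
    convert hd using 1
    simp only [Polynomial.coe_mul]
    ring
  -- Putting `X` in place of the cancelled factor respects the degree bounds and makes the constant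
  -- term vanish: this is a nonzero solution of the homogeneous Hankel system.
  have hdegQ : (X * Q₁).natDegree ≤ q := by
    rw [natDegree_mul (X_sub_C_ne_zero α) hQ₁0, natDegree_X_sub_C] at hQ
    rwa [natDegree_mul X_ne_zero hQ₁0, natDegree_X]
  have hdegP : (X * P₁).natDegree ≤ p := by
    by_cases hP₁ : P₁ = 0
    · simp [hP₁]
    · rw [natDegree_mul (X_sub_C_ne_zero α) hP₁, natDegree_X_sub_C] at hP
      rwa [natDegree_mul X_ne_zero hP₁, natDegree_X]
  have hz := eq_zero_of_hankelNonzero h hdegQ (by simp) fun v hv hvq => by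
    have h1 : PowerSeries.X ^ (p + q + 1) ∣
        ((X * Q₁ : ℂ[X]) : PowerSeries ℂ) * a - ((X * P₁ : ℂ[X]) : PowerSeries ℂ) := by
      convert Dvd.dvd.mul_left hd₁ ((X : ℂ[X]) : PowerSeries ℂ) using 1
      simp only [Polynomial.coe_mul]
      ring
    have h2 := PowerSeries.X_pow_dvd_iff.mp h1 v (by omega)
    rw [map_sub, Polynomial.coeff_coe, coeff_eq_zero_of_natDegree_lt (by omega), sub_zero] at h2
    exact h2
  exact hQ₁0 ((mul_eq_zero.mp hz).resolve_left X_ne_zero)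

/-- The Padé approximant from a numerator and a denominator that need not be normalized. -/
theorem pade_eq_div {a : PowerSeries ℂ} {p q : ℕ} (h : HankelNonzero a p q)
    {P Q : ℂ[X]} (hP : P.natDegree ≤ p) (hQ : Q.natDegree ≤ q) (h0 : Q.coeff 0 ≠ 0)
    (hd : PowerSeries.X ^ (p + q + 1) ∣ (Q : PowerSeries ℂ) * a - (P : PowerSeries ℂ)) :
    pade a p q = algebraMap ℂ[X] (RatFunc ℂ) P / algebraMap ℂ[X] (RatFunc ℂ) Q := by
  symm
  rw [← isPade_iff a p q h]
  set c := Q.coeff 0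
  have hQ1 : (C c⁻¹ * Q).coeff 0 = 1 := by
    rw [coeff_C_mul]
    exact inv_mul_cancel₀ h0
  refine ⟨C c⁻¹ * P, C c⁻¹ * Q, (natDegree_C_mul_le _ _).trans hP,
    (natDegree_C_mul_le _ _).trans hQ, hQ1, ?_, ?_⟩
  · rw [map_mul, map_mul, mul_div_mul_left]
    exact RatFunc.algebraMap_ne_zero (by simpa using h0)
  · rw [agree_iff a p q _ _ hQ1]
    intro v hv
    have h2 := PowerSeries.X_pow_dvd_iff.mp hd v (by omega)
    rw [map_sub, sub_eq_zero, Polynomial.coeff_coe] at h2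
    rw [coeff_C_mul, ← h2, Polynomial.coe_mul, mul_assoc, Polynomial.coe_C, PowerSeries.coeff_C_mul]

/-! ### Evaluating fractions of polynomials -/

lemma num_mul_eq_mul_denom {P Q : ℂ[X]} (hQ : Q ≠ 0) :
    (algebraMap ℂ[X] (RatFunc ℂ) P / algebraMap ℂ[X] (RatFunc ℂ) Q).num * Q =
      P * (algebraMap ℂ[X] (RatFunc ℂ) P / algebraMap ℂ[X] (RatFunc ℂ) Q).denom := by
  exact (RatFunc.num_mul_eq_mul_denom_iff hQ).mpr rfl

/-- The reduced denominator always divides `Q`; coprimality gives the converse divisibility, so no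
zero of `Q` is cancelled. -/
lemma eval_denom_div_eq_zero_iff {P Q : ℂ[X]} (hQ : Q ≠ 0) (hco : IsCoprime P Q) (w : ℂ) :
    (algebraMap ℂ[X] (RatFunc ℂ) P / algebraMap ℂ[X] (RatFunc ℂ) Q).denom.eval w = 0 ↔
      Q.eval w = 0 := by
  constructor
  · intro h
    exact eval_eq_zero_of_dvd_of_eval_eq_zero (RatFunc.denom_div_dvd P Q) h
  · intro h
    refine eval_eq_zero_of_dvd_of_eval_eq_zero (p := Q) ?_ h
    exact hco.symm.dvd_of_dvd_mul_left ⟨_, by rw [← num_mul_eq_mul_denom hQ, mul_comm]⟩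

lemma eval_algebraMap_div {P Q : ℂ[X]} {w : ℂ} (hw : Q.eval w ≠ 0) :
    (algebraMap ℂ[X] (RatFunc ℂ) P / algebraMap ℂ[X] (RatFunc ℂ) Q).eval (RingHom.id ℂ) w =
      P.eval w / Q.eval w := by
  have hQ : Q ≠ 0 := fun h => hw (by simp [h])
  have h1 := congrArg (Polynomial.eval w) (num_mul_eq_mul_denom (P := P) hQ)
  have h2 : (algebraMap ℂ[X] (RatFunc ℂ) P / algebraMap ℂ[X] (RatFunc ℂ) Q).denom.eval w ≠ 0 :=
    fun h => hw (eval_eq_zero_of_dvd_of_eval_eq_zero (RatFunc.denom_div_dvd P Q) h)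
  rw [eval_mul, eval_mul] at h1
  rw [RatFunc.eval, eval₂_id, eval₂_id, div_eq_div_iff h2 hw, h1]

/-! ### Padé fractions by Cramer's rule -/

/-- The denominator of the `[p/q]` Padé approximant, multiplied by the Hankel determinant. -/
def padeDenom (a : PowerSeries ℂ) (p q : ℕ) : ℂ[X] :=
  C (hankelMatrix a p q).det + revPoly ((hankelMatrix a p q).adjugate.mulVec
    fun i : Fin q => -PowerSeries.coeff (p + 1 + (i : ℕ)) a)

/-- The numerator of the `[p/q]` Padé approximant, multiplied by the Hankel determinant. -/
def padeNumer (a : PowerSeries ℂ) (p q : ℕ) : ℂ[X] :=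
  PowerSeries.trunc (p + 1) ((padeDenom a p q : PowerSeries ℂ) * a)

lemma natDegree_padeDenom_le (a : PowerSeries ℂ) (p q : ℕ) : (padeDenom a p q).natDegree ≤ q :=
  (natDegree_add_le _ _).trans (max_le (by simp) (natDegree_revPoly_le _))

lemma natDegree_padeNumer_le (a : PowerSeries ℂ) (p q : ℕ) : (padeNumer a p q).natDegree ≤ p :=
  Nat.lt_succ_iff.mp (PowerSeries.natDegree_trunc_lt _ p)

lemma coeff_zero_padeDenom (a : PowerSeries ℂ) (p q : ℕ) :
    (padeDenom a p q).coeff 0 = (hankelMatrix a p q).det := by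
  rw [padeDenom, coeff_add, coeff_zero_revPoly, coeff_C_zero, add_zero]

/-- Cramer's rule: a matrix times its adjugate is its determinant. Using the adjugate instead of the
inverse keeps the coefficients polynomial in those of `a`, hence continuous in `f`, even where the
determinant vanishes. -/
lemma X_pow_dvd_padeDenom_mul_sub (a : PowerSeries ℂ) (p q : ℕ) :
    PowerSeries.X ^ (p + q + 1) ∣ (padeDenom a p q : PowerSeries ℂ) * a -
      (padeNumer a p q : PowerSeries ℂ) := by
  refine X_pow_dvd_mul_sub_trunc fun i => ?_
  rw [padeDenom, Polynomial.coe_add, add_mul, map_add, Polynomial.coe_C, PowerSeries.coeff_C_mul,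
    coeff_mul_eq_hankel_mulVec a p q _ (natDegree_revPoly_le _) (coeff_zero_revPoly _)]
  simp only [coeff_revPoly]
  rw [Matrix.mulVec_mulVec, Matrix.mul_adjugate, Matrix.smul_mulVec, Matrix.one_mulVec]
  simp

/-! ### The space of holomorphic functions -/

section Hol

variable {Ω : Set ℂ}

lemma extZero_apply (f : Ω → ℂ) (z : Ω) : extZero f z = f z :=
  Subtype.val_injective.extend_apply _ _ _

/-- The element of `Hol Ω` defined by a function that is holomorphic on `Ω`. -/
def holOfDifferentiableOn (g : ℂ → ℂ) (hg : DifferentiableOn ℂ g Ω) : Hol Ω :=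
  ⟨⟨Ω.domRestrict g, hg.continuousOn.domRestrict⟩, hg.congr fun z hz => extZero_apply _ ⟨z, hz⟩⟩

lemma extZero_holOfDifferentiableOn (g : ℂ → ℂ) (hg : DifferentiableOn ℂ g Ω) {z : ℂ}
    (hz : z ∈ Ω) : extZero (holOfDifferentiableOn g hg).1 z = g z :=
  extZero_apply _ ⟨z, hz⟩

lemma tendsto_iff_tendstoUniformlyOn_extZero {ι : Type*} {l : Filter ι} {F : ι → C(Ω, ℂ)}
    {f : C(Ω, ℂ)} : Tendsto F l (𝓝 f) ↔ ∀ K : Set ℂ, IsCompact K → K ⊆ Ω →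
      TendstoUniformlyOn (fun i => extZero (F i)) (extZero f) l K := by
  rw [ContinuousMap.tendsto_iff_forall_isCompact_tendstoUniformlyOn]
  simp only [Metric.tendstoUniformlyOn_iff]
  constructor
  · intro h K hK hKΩ ε hε
    have hK' : IsCompact ((↑) ⁻¹' K : Set Ω) :=
      Topology.IsInducing.subtypeVal.isCompact_preimage' hK (by simpa using hKΩ)
    filter_upwards [h _ hK' ε hε] with i hi z hz
    have := hi ⟨z, hKΩ hz⟩ hz
    rwa [← extZero_apply f, ← extZero_apply (F i)] at this
  · intro h K hK ε hε
    filter_upwards [h _ (hK.image continuous_subtype_val) (Subtype.coe_image_subset _ _) ε hε]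
      with i hi z hz
    have := hi z ⟨z, hz, rfl⟩
    rwa [extZero_apply, extZero_apply] at this

lemma tendstoLocallyUniformlyOn_extZero (hΩ : IsOpen Ω) {ι : Type*} {l : Filter ι}
    {F : ι → C(Ω, ℂ)} {f : C(Ω, ℂ)} (h : Tendsto F l (𝓝 f)) :
    TendstoLocallyUniformlyOn (fun i => extZero (F i)) (extZero f) l Ω := by
  rw [tendstoLocallyUniformlyOn_iff_forall_isCompact hΩ]
  exact fun K hKΩ hK => tendsto_iff_tendstoUniformlyOn_extZero.mp h K hK hKΩ

/-- Locally uniform limits of holomorphic functions are holomorphic, so `Hol Ω` is closed in the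
complete space `C(Ω, ℂ)`, whose uniformity is countably generated. -/
lemma baireSpace_hol (hΩ : IsOpen Ω) : BaireSpace (Hol Ω) := by
  have := hΩ.locallyCompactSpace
  have hcl : IsClosed {f : C(Ω, ℂ) | DifferentiableOn ℂ (extZero f) Ω} := by
    refine IsSeqClosed.isClosed fun F f hF hf => ?_
    exact (tendstoLocallyUniformlyOn_extZero hΩ hf).differentiableOn (Eventually.of_forall hF) hΩ
  have : CompleteSpace (Hol Ω) := hcl.completeSpace_coe
  have : (uniformity (Hol Ω)).IsCountablyGenerated := by
    rw [uniformity_subtype]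
    infer_instance
  infer_instance

lemma tendstoLocallyUniformlyOn_iteratedDeriv (hΩ : IsOpen Ω) {ι : Type*} {l : Filter ι}
    {F : ι → ℂ → ℂ} {f : ℂ → ℂ} (h : TendstoLocallyUniformlyOn F f l Ω)
    (hF : ∀ i, DifferentiableOn ℂ (F i) Ω) (v : ℕ) :
    TendstoLocallyUniformlyOn (fun i => iteratedDeriv v (F i)) (iteratedDeriv v f) l Ω := by
  induction v generalizing F f with
  | zero => simpa using h
  | succ v ih =>
    simp only [iteratedDeriv_succ']
    exact ih (h.deriv (Eventually.of_forall hF) hΩ) fun i => (hF i).deriv hΩ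

lemma continuous_coeff_taylorSeries (hΩ : IsOpen Ω) {ζ : ℂ} (hζ : ζ ∈ Ω) (v : ℕ) :
    Continuous fun f : Hol Ω => PowerSeries.coeff v (taylorSeries f ζ) := by
  rw [continuous_iff_continuousAt]
  intro f
  have h1 := tendstoLocallyUniformlyOn_extZero hΩ (continuous_subtype_val.tendsto f)
  have h2 := (tendstoLocallyUniformlyOn_iteratedDeriv hΩ h1 (fun g => g.2) v).tendsto_at hζ
  simp only [ContinuousAt, taylorSeries, PowerSeries.coeff_mk]
  exact h2.div_const _

lemma continuous_eval_extZero (hΩ : IsOpen Ω) :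
    Continuous fun x : Hol Ω × Ω => extZero x.1.1 x.2 := by
  have := hΩ.locallyCompactSpace
  simp only [extZero_apply]
  fun_prop

/-- A compact exhaustion of `Ω`. -/
def compactPart (Ω : Set ℂ) (m : ℕ) : Set ℂ :=
  {z | ‖z‖ ≤ m ∧ ∀ w ∉ Ω, 1 / ((m : ℝ) + 1) ≤ ‖z - w‖}

lemma isCompact_compactPart (Ω : Set ℂ) (m : ℕ) : IsCompact (compactPart Ω m) := by
  refine Metric.isCompact_of_isClosed_isBounded ?_ ?_
  · simp only [compactPart, Set.ofPred_and, Set.ofPred_forall]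
    refine (isClosed_le (by fun_prop) (by fun_prop)).inter ?_
    exact isClosed_iInter fun w => isClosed_iInter fun _ => isClosed_le (by fun_prop) (by fun_prop)
  · exact Metric.isBounded_closedBall.subset fun z hz => mem_closedBall_zero_iff.mpr hz.1

lemma compactPart_subset (Ω : Set ℂ) (m : ℕ) : compactPart Ω m ⊆ Ω := by
  intro z hz
  by_contra h
  have h1 := hz.2 z h
  rw [sub_self, norm_zero] at h1
  have : 0 < 1 / ((m : ℝ) + 1) := by positivity
  linarith

lemma compactPart_mono (Ω : Set ℂ) : Monotone (compactPart Ω) := by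
  intro m n hmn z hz
  have hmn' : (m : ℝ) ≤ n := by exact_mod_cast hmn
  refine ⟨hz.1.trans hmn', fun w hw => le_trans ?_ (hz.2 w hw)⟩
  exact one_div_le_one_div_of_le (by positivity) (by linarith)

lemma exists_subset_compactPart (hΩ : IsOpen Ω) {K : Set ℂ} (hK : IsCompact K) (hKΩ : K ⊆ Ω) :
    ∃ m, K ⊆ compactPart Ω m := by
  obtain ⟨δ, hδ, hthick⟩ := hK.exists_thickening_subset_open hΩ hKΩ
  obtain ⟨R, hR⟩ := hK.isBounded.subset_closedBall 0
  obtain ⟨m₁, hm₁⟩ := exists_nat_ge R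
  obtain ⟨m₂, hm₂⟩ := exists_nat_one_div_lt hδ
  refine ⟨max m₁ m₂, fun z hz => ⟨?_, fun w hw => ?_⟩⟩
  · have h1 := mem_closedBall_zero_iff.mp (hR hz)
    have h2 : (m₁ : ℝ) ≤ (max m₁ m₂ : ℕ) := by exact_mod_cast le_max_left _ _
    linarith
  · have h2 : (m₂ : ℝ) ≤ (max m₁ m₂ : ℕ) := by exact_mod_cast le_max_right _ _
    have h3 : 1 / (((max m₁ m₂ : ℕ) : ℝ) + 1) ≤ 1 / ((m₂ : ℝ) + 1) :=
      one_div_le_one_div_of_le (by positivity) (by linarith)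
    by_contra! h
    refine hw (hthick (Metric.mem_thickening_iff.mpr ⟨z, hz, ?_⟩))
    rw [dist_comm, dist_eq_norm]
    linarith

/-- A point outside violates one of the two defining inequalities, which every point inside
satisfies; this is the hypothesis `hsep` of Runge's theorem, with no discussion of holes. -/
lemma compactPart_separation (Ω : Set ℂ) (m : ℕ) (a : ℂ) (ha : a ∉ compactPart Ω m) :
    (∀ z ∈ compactPart Ω m, ‖z‖ < ‖a‖) ∨
      ∃ w ∉ Ω, ∀ z ∈ compactPart Ω m, ‖a - w‖ < ‖z - w‖ := by
  by_cases h : ‖a‖ ≤ m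
  · right
    have : ¬ ∀ w ∉ Ω, 1 / ((m : ℝ) + 1) ≤ ‖a - w‖ := fun h' => ha ⟨h, h'⟩
    push Not at this
    obtain ⟨w, hw, hlt⟩ := this
    exact ⟨w, hw, fun z hz => hlt.trans_le (hz.2 w hw)⟩
  · left
    exact fun z hz => hz.1.trans_lt (not_le.mp h)

lemma tendsto_hol_of_norm_sub_lt (hΩ : IsOpen Ω) {h : ℕ → Hol Ω} {f : Hol Ω}
    (hlt : ∀ m, ∀ z ∈ compactPart Ω m, ‖extZero (h m).1 z - extZero f.1 z‖ < 1 / ((m : ℝ) + 1)) :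
    Tendsto h atTop (𝓝 f) := by
  rw [tendsto_subtype_rng, tendsto_iff_tendstoUniformlyOn_extZero]
  intro K hK hKΩ
  obtain ⟨m₀, hm₀⟩ := exists_subset_compactPart hΩ hK hKΩ
  rw [Metric.tendstoUniformlyOn_iff]
  intro ε hε
  obtain ⟨m₁, hm₁⟩ := exists_nat_one_div_lt hε
  filter_upwards [eventually_ge_atTop m₀, eventually_ge_atTop m₁] with m h0 h1 z hz
  rw [dist_comm, dist_eq_norm]
  refine (hlt m z (compactPart_mono Ω h0 (hm₀ hz))).trans (lt_of_le_of_lt ?_ hm₁)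
  have : (m₁ : ℝ) ≤ m := by exact_mod_cast h1
  exact one_div_le_one_div_of_le (by positivity) (by linarith)

end Hol

/-! ### Taylor series of products -/

/-- The Taylor series at `ζ` of a function on `ℂ`, in the variable `z - ζ`. -/
def taylorAt (g : ℂ → ℂ) (ζ : ℂ) : PowerSeries ℂ :=
  PowerSeries.mk fun v => iteratedDeriv v g ζ / (v.factorial : ℂ)

lemma taylorAt_congr {g h : ℂ → ℂ} {ζ : ℂ} (e : g =ᶠ[𝓝 ζ] h) : taylorAt g ζ = taylorAt h ζ := by
  ext v
  simp only [taylorAt, PowerSeries.coeff_mk, e.iteratedDeriv_eq v]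

/-- The Leibniz rule divided by `v!` is the Cauchy product. -/
lemma taylorAt_mul {g h : ℂ → ℂ} {ζ : ℂ} (hg : AnalyticAt ℂ g ζ) (hh : AnalyticAt ℂ h ζ) :
    taylorAt (g * h) ζ = taylorAt g ζ * taylorAt h ζ := by
  ext v
  rw [PowerSeries.coeff_mul, Finset.Nat.sum_antidiagonal_eq_sum_range_succ_mk]
  simp only [taylorAt, PowerSeries.coeff_mk]
  rw [iteratedDeriv_mul hg.contDiffAt hh.contDiffAt, Finset.sum_div]
  refine Finset.sum_congr rfl fun i hi => ?_
  have hi' : i ≤ v := Finset.mem_range_succ_iff.mp hi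
  rw [Nat.cast_choose ℂ hi']
  have h1 : (v.factorial : ℂ) ≠ 0 := by exact_mod_cast v.factorial_ne_zero
  have h2 : (i.factorial : ℂ) ≠ 0 := by exact_mod_cast i.factorial_ne_zero
  have h3 : ((v - i).factorial : ℂ) ≠ 0 := by exact_mod_cast (v - i).factorial_ne_zero
  field_simp

lemma taylorAt_polynomial (P : ℂ[X]) (ζ : ℂ) :
    taylorAt (fun z => P.eval (z - ζ)) ζ = (P : PowerSeries ℂ) := by
  have h : ∀ v, iteratedDeriv v (fun z => P.eval (z - ζ)) =
      fun z => (derivative^[v] P).eval (z - ζ) := by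
    intro v
    induction v with
    | zero => simp
    | succ v ih =>
      rw [iteratedDeriv_succ, ih]
      funext z
      rw [deriv_comp_sub_const (f := fun z => (derivative^[v] P).eval z), Polynomial.deriv,
        Function.iterate_succ_apply']
  ext v
  have hv : (v.factorial : ℂ) ≠ 0 := by exact_mod_cast v.factorial_ne_zero
  rw [taylorAt, PowerSeries.coeff_mk, h, Polynomial.coeff_coe]
  dsimp only
  rw [sub_self, ← coeff_zero_eq_eval_zero,
    coeff_iterate_derivative, zero_add, Nat.descFactorial_self, nsmul_eq_mul]
  field_simp

/-- Gives the Taylor series of a rational function without computing derivatives. -/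
lemma coe_mul_taylorSeries {Ω : Set ℂ} (hΩ : IsOpen Ω) {ζ : ℂ} (hζ : ζ ∈ Ω) (f : Hol Ω)
    {A B : ℂ[X]} (h : ∀ z ∈ Ω, B.eval (z - ζ) * extZero f.1 z = A.eval (z - ζ)) :
    (B : PowerSeries ℂ) * taylorSeries f ζ = (A : PowerSeries ℂ) := by
  have h1 : AnalyticAt ℂ (extZero f.1) ζ := f.2.analyticAt (hΩ.mem_nhds hζ)
  have h2 : AnalyticAt ℂ (fun z => B.eval (z - ζ)) ζ :=
    Differentiable.analyticAt (B.differentiable.comp (differentiable_id.sub_const ζ)) ζ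
  rw [← taylorAt_polynomial A ζ, ← taylorAt_polynomial B ζ]
  change _ * taylorAt (extZero f.1) ζ = _
  rw [← taylorAt_mul h2 h1]
  refine taylorAt_congr ?_
  filter_upwards [hΩ.mem_nhds hζ] with z hz
  exact h z hz

variable {Ω : Set ℂ}

/-! ### The open sets of the `G_δ` representation -/

/-- The functions in `𝒟_{p,q}(ζ)` whose `[p/q]` Padé approximant is `1 / (m + 1)`-close to them on
the `m`-th compact part of `Ω`. -/
def approxSet (Ω : Set ℂ) (ζ : ℂ) (p q m : ℕ) : Set (Hol Ω) :=
  {f | MemD f ζ p q ∧ ∀ z ∈ compactPart Ω m, ¬ IsPadePole f ζ p q z ∧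
    ‖padeValue f ζ p q z - extZero f.1 z‖ < 1 / ((m : ℝ) + 1)}

lemma approxSet_anti (Ω : Set ℂ) (ζ : ℂ) (p q : ℕ) : Antitone (approxSet Ω ζ p q) := by
  intro m n hmn f hf
  refine ⟨hf.1, fun z hz => ?_⟩
  have h := hf.2 z (compactPart_mono Ω hmn hz)
  have hmn' : (m : ℝ) ≤ n := by exact_mod_cast hmn
  exact ⟨h.1, h.2.trans_le (one_div_le_one_div_of_le (by positivity) (by linarith))⟩

/-- The nonzero Hankel determinant makes `P` and `Q` coprime, so every zero of `Q` is a genuine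
pole. -/
lemma isPadePole_iff {f : Hol Ω} {ζ : ℂ} {p q : ℕ} (hD : MemD f ζ p q) {P Q : ℂ[X]}
    (hP : P.natDegree ≤ p) (hQ : Q.natDegree ≤ q) (h0 : Q.coeff 0 ≠ 0)
    (hd : PowerSeries.X ^ (p + q + 1) ∣ (Q : PowerSeries ℂ) * taylorSeries f ζ -
      (P : PowerSeries ℂ)) (z : ℂ) :
    IsPadePole f ζ p q z ↔ Q.eval (z - ζ) = 0 := by
  rw [IsPadePole, pade_eq_div hD hP hQ h0 hd]
  exact eval_denom_div_eq_zero_iff (fun h => h0 (by simp [h]))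
    (isCoprime_of_hankelNonzero hD hP hQ h0 hd) _

lemma padeValue_eq {f : Hol Ω} {ζ : ℂ} {p q : ℕ} (hD : MemD f ζ p q) {P Q : ℂ[X]}
    (hP : P.natDegree ≤ p) (hQ : Q.natDegree ≤ q) (h0 : Q.coeff 0 ≠ 0)
    (hd : PowerSeries.X ^ (p + q + 1) ∣ (Q : PowerSeries ℂ) * taylorSeries f ζ -
      (P : PowerSeries ℂ)) {z : ℂ} (hz : Q.eval (z - ζ) ≠ 0) :
    padeValue f ζ p q z = P.eval (z - ζ) / Q.eval (z - ζ) := by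
  rw [padeValue, pade_eq_div hD hP hQ h0 hd, eval_algebraMap_div hz]

/-- Clearing denominators absorbs the absence of poles: the strict inequality fails wherever the
denominator is zero. What remains is a strict inequality between functions continuous in `(f, z)`.
-/
lemma mem_approxSet_iff (f : Hol Ω) (ζ : ℂ) (p q m : ℕ) :
    f ∈ approxSet Ω ζ p q m ↔ MemD f ζ p q ∧ ∀ z ∈ compactPart Ω m,
      ‖(padeNumer (taylorSeries f ζ) p q).eval (z - ζ) -
          extZero f.1 z * (padeDenom (taylorSeries f ζ) p q).eval (z - ζ)‖ <
        1 / ((m : ℝ) + 1) * ‖(padeDenom (taylorSeries f ζ) p q).eval (z - ζ)‖ := by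
  refine and_congr_right fun hD => forall₂_congr fun z hz => ?_
  have hP := natDegree_padeNumer_le (taylorSeries f ζ) p q
  have hQ := natDegree_padeDenom_le (taylorSeries f ζ) p q
  have h0 : (padeDenom (taylorSeries f ζ) p q).coeff 0 ≠ 0 := by
    rw [coeff_zero_padeDenom]
    exact hD
  have hd := X_pow_dvd_padeDenom_mul_sub (taylorSeries f ζ) p q
  set P := padeNumer (taylorSeries f ζ) p q
  set Q := padeDenom (taylorSeries f ζ) p q
  rw [isPadePole_iff hD hP hQ h0 hd]
  have key : ∀ hz : Q.eval (z - ζ) ≠ 0,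
      (‖padeValue f ζ p q z - extZero f.1 z‖ < 1 / ((m : ℝ) + 1) ↔
        ‖P.eval (z - ζ) - extZero f.1 z * Q.eval (z - ζ)‖ <
          1 / ((m : ℝ) + 1) * ‖Q.eval (z - ζ)‖) := by
    intro hz
    rw [padeValue_eq hD hP hQ h0 hd hz, ← div_lt_iff₀ (norm_pos_iff.mpr hz), ← norm_div, sub_div,
      mul_div_cancel_right₀ _ hz]
  constructor
  · rintro ⟨hz, h⟩
    exact (key hz).mp h
  · intro h
    have hz : Q.eval (z - ζ) ≠ 0 := by
      intro h'
      rw [h', norm_zero, mul_zero, mul_zero] at h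
      exact (norm_nonneg _).not_gt h
    exact ⟨hz, (key hz).mpr h⟩

lemma continuous_hankelMatrix (hΩ : IsOpen Ω) {ζ : ℂ} (hζ : ζ ∈ Ω) (p q : ℕ) :
    Continuous fun f : Hol Ω => hankelMatrix (taylorSeries f ζ) p q := by
  refine continuous_matrix fun i j => ?_
  simp only [hankelMatrix, Matrix.of_apply, coeffInt]
  split_ifs
  · exact continuous_const
  · exact continuous_coeff_taylorSeries hΩ hζ _

lemma continuous_coeff_padeDenom (hΩ : IsOpen Ω) {ζ : ℂ} (hζ : ζ ∈ Ω) (p q k : ℕ) :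
    Continuous fun f : Hol Ω => (padeDenom (taylorSeries f ζ) p q).coeff k := by
  have hH := continuous_hankelMatrix hΩ hζ p q
  have hx : Continuous fun f : Hol Ω => (hankelMatrix (taylorSeries f ζ) p q).adjugate.mulVec
      fun i : Fin q => -PowerSeries.coeff (p + 1 + (i : ℕ)) (taylorSeries f ζ) :=
    hH.matrix_adjugate.matrix_mulVec
      (continuous_pi fun i => (continuous_coeff_taylorSeries hΩ hζ _).neg)
  simp only [padeDenom, revPoly, coeff_add, coeff_C, finsetSum_coeff, coeff_monomial]
  refine Continuous.add ?_ (continuous_finsetSum _ fun j _ => ?_)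
  · split_ifs
    · exact hH.matrix_det
    · exact continuous_const
  · split_ifs
    · exact (continuous_apply j).comp hx
    · exact continuous_const

lemma continuous_coeff_padeNumer (hΩ : IsOpen Ω) {ζ : ℂ} (hζ : ζ ∈ Ω) (p q k : ℕ) :
    Continuous fun f : Hol Ω => (padeNumer (taylorSeries f ζ) p q).coeff k := by
  simp only [padeNumer, PowerSeries.coeff_trunc, PowerSeries.coeff_mul, Polynomial.coeff_coe]
  split_ifs
  · exact continuous_finsetSum _ fun x _ => (continuous_coeff_padeDenom hΩ hζ p q _).mul
      (continuous_coeff_taylorSeries hΩ hζ _)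
  · exact continuous_const

lemma continuous_eval_of_continuous_coeff {Y : Type*} [TopologicalSpace Y] {P : Y → ℂ[X]} {n : ℕ}
    (hn : ∀ y, (P y).natDegree ≤ n) (hP : ∀ k, Continuous fun y => (P y).coeff k) :
    Continuous fun x : Y × ℂ => (P x.1).eval x.2 := by
  have : (fun x : Y × ℂ => (P x.1).eval x.2) =
      fun x : Y × ℂ => ∑ k ∈ Finset.range (n + 1), (P x.1).coeff k * x.2 ^ k :=
    funext fun x => eval_eq_sum_range' (Nat.lt_succ_of_le (hn x.1)) x.2
  rw [this]
  exact continuous_finsetSum _ fun k _ => ((hP k).comp continuous_fst).mul (by fun_prop)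

/-- A strict inequality between jointly continuous functions that holds at `f` on a compact set
persists, uniformly in `z`, for nearby functions. -/
lemma isOpen_approxSet (hΩ : IsOpen Ω) {ζ : ℂ} (hζ : ζ ∈ Ω) (p q m : ℕ) :
    IsOpen (approxSet Ω ζ p q m) := by
  have h1 : IsOpen {f : Hol Ω | MemD f ζ p q} :=
    isOpen_ne_fun (continuous_hankelMatrix hΩ hζ p q).matrix_det continuous_const
  have hN : Continuous fun x : Hol Ω × Ω =>
      (padeNumer (taylorSeries x.1 ζ) p q).eval ((x.2 : ℂ) - ζ) :=
    (continuous_eval_of_continuous_coeff (fun f => natDegree_padeNumer_le _ p q)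
      (continuous_coeff_padeNumer hΩ hζ p q)).comp
      (by fun_prop : Continuous fun x : Hol Ω × Ω => (x.1, (x.2 : ℂ) - ζ))
  have hD : Continuous fun x : Hol Ω × Ω =>
      (padeDenom (taylorSeries x.1 ζ) p q).eval ((x.2 : ℂ) - ζ) :=
    (continuous_eval_of_continuous_coeff (fun f => natDegree_padeDenom_le _ p q)
      (continuous_coeff_padeDenom hΩ hζ p q)).comp
      (by fun_prop : Continuous fun x : Hol Ω × Ω => (x.1, (x.2 : ℂ) - ζ))
  have hE := continuous_eval_extZero hΩ
  have hK : IsCompact ((↑) ⁻¹' compactPart Ω m : Set Ω) :=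
    Topology.IsInducing.subtypeVal.isCompact_preimage' (isCompact_compactPart Ω m)
      (by simpa using compactPart_subset Ω m)
  rw [isOpen_iff_mem_nhds]
  intro f hf
  rw [mem_approxSet_iff] at hf
  have h2 := hK.eventually_forall_of_forall_eventually (x₀ := f)
    (P := fun g z => ‖(padeNumer (taylorSeries g ζ) p q).eval ((z : ℂ) - ζ) -
          extZero g.1 z * (padeDenom (taylorSeries g ζ) p q).eval ((z : ℂ) - ζ)‖ <
        1 / ((m : ℝ) + 1) * ‖(padeDenom (taylorSeries g ζ) p q).eval ((z : ℂ) - ζ)‖)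
    fun z hz => (isOpen_lt (hN.sub (hE.mul hD)).norm (continuous_const.mul hD.norm)).mem_nhds
      (hf.2 z hz)
  filter_upwards [h1.mem_nhds hf.1, h2] with g hg1 hg2
  rw [mem_approxSet_iff]
  exact ⟨hg1, fun z hz => hg2 ⟨z, compactPart_subset Ω m hz⟩ hz⟩

lemma mem_approxSet_of_isCoprime {f : Hol Ω} {ζ : ℂ} {p q m : ℕ} {P Q : ℂ[X]}
    (hP : P.natDegree ≤ p) (hQ : Q.natDegree = q) (h0 : Q.coeff 0 ≠ 0) (hco : IsCoprime P Q)
    (hd : PowerSeries.X ^ (p + q + 1) ∣ (Q : PowerSeries ℂ) * taylorSeries f ζ -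
      (P : PowerSeries ℂ))
    (hK : ∀ z ∈ compactPart Ω m, Q.eval (z - ζ) ≠ 0 ∧
      ‖P.eval (z - ζ) / Q.eval (z - ζ) - extZero f.1 z‖ < 1 / ((m : ℝ) + 1)) :
    f ∈ approxSet Ω ζ p q m := by
  have hD : MemD f ζ p q := hankelNonzero_of_isCoprime hP hQ h0 hco hd
  refine ⟨hD, fun z hz => ⟨?_, ?_⟩⟩
  · rw [isPadePole_iff hD hP hQ.le h0 hd]
    exact (hK z hz).1
  · rw [padeValue_eq hD hP hQ.le h0 hd (hK z hz).1]
    exact (hK z hz).2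

/-! ### Density -/

/-- A rational function without poles in `Ω` is approximated on compact sets by elements of `Hol Ω`
whose `[p/q]` Padé approximant is `A / (B * (1 + δ X ^ r))`, for small `δ`. -/
theorem exists_mem_approxSet_near_rational (hΩ : IsOpen Ω) {ζ : ℂ} (hζ : ζ ∈ Ω) {A B : ℂ[X]}
    (hA0 : A ≠ 0) (hco : IsCoprime A B) (hB : ∀ z ∈ Ω, B.eval (z - ζ) ≠ 0) {p q : ℕ}
    (hp : A.natDegree ≤ p) (hq : B.natDegree < q) (m : ℕ) {ε : ℝ} (hε : 0 < ε) :
    ∃ h ∈ approxSet Ω ζ p q m, ∀ z ∈ compactPart Ω m,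
      ‖extZero h.1 z - A.eval (z - ζ) / B.eval (z - ζ)‖ < ε := by
  obtain ⟨r, hr0, hr⟩ : ∃ r, r ≠ 0 ∧ B.natDegree + r = q := ⟨q - B.natDegree, by omega, by omega⟩
  have hB0 : B.coeff 0 ≠ 0 := by
    have := hB ζ hζ
    rwa [sub_self, ← coeff_zero_eq_eval_zero] at this
  have hBne : B ≠ 0 := fun h => hB0 (by simp [h])
  set N := p + q + 1 with hN
  -- The partial geometric sum stands for `1 / (1 + δ (z - ζ) ^ r)`, which may have poles in `Ω`;
  -- with `N = p + q + 1` terms and `r ≥ 1` the discrepancy has order at least `N`.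
  let g : ℂ → ℂ → ℂ := fun δ z =>
    A.eval (z - ζ) / B.eval (z - ζ) * ∑ k ∈ Finset.range N, (-(δ * (z - ζ) ^ r)) ^ k
  have hcA : Continuous fun x : ℂ × ℂ => A.eval (x.2 - ζ) := A.continuous.comp (by fun_prop)
  have hcB : Continuous fun x : ℂ × ℂ => B.eval (x.2 - ζ) := B.continuous.comp (by fun_prop)
  have hg : ∀ z ∈ Ω, ContinuousAt (fun x : ℂ × ℂ => g x.1 x.2) (0, z) := by
    intro z hz
    exact (hcA.continuousAt.div hcB.continuousAt (hB z hz)).mul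
      (by fun_prop : Continuous fun x : ℂ × ℂ =>
        ∑ k ∈ Finset.range N, (-(x.1 * (x.2 - ζ) ^ r)) ^ k).continuousAt
  have hg0 : ∀ z, g 0 z = A.eval (z - ζ) / B.eval (z - ζ) := by
    intro z
    simp only [g, zero_mul, neg_zero]
    rw [Finset.sum_eq_single_of_mem 0 (by simp [hN]) (fun k _ hk => zero_pow hk), pow_zero, mul_one]
  have hK := isCompact_compactPart Ω m
  have e1 : ∀ᶠ δ in 𝓝 (0 : ℂ), ∀ z ∈ compactPart Ω m,
      ‖g δ z - A.eval (z - ζ) / B.eval (z - ζ)‖ < ε := by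
    refine hK.eventually_forall_of_forall_eventually fun z hz => ?_
    have hzΩ := compactPart_subset Ω m hz
    have hc := ((hg z hzΩ).sub (hcA.continuousAt.div hcB.continuousAt (hB z hzΩ))).norm
    exact hc.eventually_lt_const (by simpa [hg0] using hε)
  have hE : Continuous fun x : ℂ × ℂ => 1 + x.1 * (x.2 - ζ) ^ r := by fun_prop
  have e2 : ∀ᶠ δ in 𝓝 (0 : ℂ), ∀ z ∈ compactPart Ω m, 1 + δ * (z - ζ) ^ r ≠ 0 :=
    hK.eventually_forall_of_forall_eventually fun z hz =>
      hE.continuousAt.eventually_ne (by simp)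
  have e3 : ∀ᶠ δ in 𝓝 (0 : ℂ), ∀ z ∈ compactPart Ω m,
      ‖A.eval (z - ζ) / (B.eval (z - ζ) * (1 + δ * (z - ζ) ^ r)) - g δ z‖ < 1 / ((m : ℝ) + 1) := by
    refine hK.eventually_forall_of_forall_eventually fun z hz => ?_
    have hzΩ := compactPart_subset Ω m hz
    have hc := ((ContinuousAt.div (a := ((0 : ℂ), z)) hcA.continuousAt (hcB.mul hE).continuousAt
      (by simpa using hB z hzΩ)).sub (hg z hzΩ)).norm
    have hη : 0 < 1 / ((m : ℝ) + 1) := by positivity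
    generalize 1 / ((m : ℝ) + 1) = η at hη ⊢
    exact hc.eventually_lt_const (by simpa [hg0] using hη)
  -- No root of `A` may be a root of the new factor, so that the fraction stays in lowest terms.
  have e4 : ∀ᶠ δ in 𝓝 (0 : ℂ), ∀ α ∈ A.roots.toFinset, 1 + δ * α ^ r ≠ 0 := by
    rw [Filter.eventually_all_finset]
    intro α _
    exact (by fun_prop : Continuous fun δ : ℂ => 1 + δ * α ^ r).continuousAt.eventually_ne (by simp)
  -- With `δ = 0` the degree of the denominator would drop below `q`.
  have e5 : ∀ᶠ δ in 𝓝[≠] (0 : ℂ), δ ≠ 0 := eventually_mem_nhdsWithin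
  obtain ⟨δ, hδ0, h1, h2, h3, h4⟩ := (e5.and (((e1.and (e2.and (e3.and e4)))).filter_mono
    nhdsWithin_le_nhds)).exists
  have hdiff : DifferentiableOn ℂ (g δ) Ω := by
    have hA' : Differentiable ℂ fun z => A.eval (z - ζ) :=
      A.differentiable.comp (differentiable_id.sub_const ζ)
    have hB' : Differentiable ℂ fun z => B.eval (z - ζ) :=
      B.differentiable.comp (differentiable_id.sub_const ζ)
    exact (hA'.differentiableOn.div hB'.differentiableOn hB).mul
      (by fun_prop : Differentiable ℂ fun z : ℂ =>
        ∑ k ∈ Finset.range N, (-(δ * (z - ζ) ^ r)) ^ k).differentiableOn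
  have hval := fun {z : ℂ} (hz : z ∈ compactPart Ω m) =>
    extZero_holOfDifferentiableOn (g δ) hdiff (compactPart_subset Ω m hz)
  set E : ℂ[X] := 1 + C δ * X ^ r with hEdef
  set G : ℂ[X] := ∑ k ∈ Finset.range N, (-(C δ * X ^ r)) ^ k with hGdef
  have hEe : ∀ w, E.eval w = 1 + δ * w ^ r := fun w => by simp [hEdef]
  have hEG : E * G = 1 - (-(C δ * X ^ r)) ^ N := by
    rw [← mul_neg_geom_sum, sub_neg_eq_add]
  have hEd : E.natDegree = r := by
    rw [hEdef, add_comm, ← C_1, natDegree_add_C, natDegree_C_mul_X_pow r δ hδ0]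
  have hE0 : E.coeff 0 ≠ 0 := by
    rw [coeff_zero_eq_eval_zero, hEe, zero_pow hr0]
    simp
  have hEne : E ≠ 0 := fun h => hE0 (by simp [h])
  have hAE : IsCoprime A E := by
    rw [isCoprime_iff_aeval_ne_zero_of_isAlgClosed ℂ ℂ]
    intro α
    rw [coe_aeval_eq_eval]
    by_cases hα : A.eval α = 0
    · right
      rw [hEe]
      exact h4 α (by simpa [hA0] using hα)
    · exact Or.inl hα
  refine ⟨holOfDifferentiableOn (g δ) hdiff, ?_, fun z hz => ?_⟩
  · refine mem_approxSet_of_isCoprime (P := A) (Q := B * E) hp ?_ ?_ (hco.mul_right hAE) ?_ ?_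
    · rw [natDegree_mul hBne hEne, hEd, hr]
    · rw [mul_coeff_zero]
      exact mul_ne_zero hB0 hE0
    · have ht := coe_mul_taylorSeries hΩ hζ (holOfDifferentiableOn (g δ) hdiff)
        (A := A * G) (B := B) fun z hz => by
          rw [extZero_holOfDifferentiableOn _ _ hz]
          simp only [g, hGdef, eval_mul, eval_finsetSum, eval_pow, eval_neg, eval_C, eval_X]
          rw [← mul_assoc, mul_div_cancel₀ _ (hB z hz)]
      -- The remainder is `A (E G - 1) = -A (-δ X ^ r) ^ N`, divisible by `X ^ N`.
      have h5 : ((B * E : ℂ[X]) : PowerSeries ℂ) *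
          taylorSeries (holOfDifferentiableOn (g δ) hdiff) ζ - (A : PowerSeries ℂ) =
          ((A * (E * G) - A : ℂ[X]) : PowerSeries ℂ) := by
        simp only [Polynomial.coe_mul, Polynomial.coe_sub] at ht ⊢
        linear_combination (E : PowerSeries ℂ) * ht
      rw [h5, hEG, ← hN, ← Polynomial.coe_X, ← Polynomial.coe_pow]
      suffices hdvd : (X : ℂ[X]) ^ N ∣ A * (1 - (-(C δ * X ^ r)) ^ N) - A by
        simpa using _root_.map_dvd (Polynomial.coeToPowerSeries.ringHom (R := ℂ)) hdvd
      rw [show A * (1 - (-(C δ * X ^ r)) ^ N) - A = -(A * (-(C δ * X ^ r)) ^ N) by ring, dvd_neg]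
      refine Dvd.dvd.mul_left (pow_dvd_pow_of_dvd ?_ N) _
      rw [dvd_neg]
      exact Dvd.dvd.mul_left (dvd_pow_self X hr0) _
    · intro z hz
      rw [hval hz, eval_mul, hEe]
      exact ⟨mul_ne_zero (hB z (compactPart_subset Ω m hz)) (h2 z hz), h3 z hz⟩
  · rw [hval hz]
    exact h1 z hz

/-- Runge approximation by a nonzero fraction in lowest terms. -/
lemma exists_coprime_rational_approx (hΩ : IsOpen Ω) (ζ : ℂ) (f : Hol Ω) (m : ℕ) {ε : ℝ}
    (hε : 0 < ε) : ∃ A B : ℂ[X], A ≠ 0 ∧ IsCoprime A B ∧ (∀ z ∈ Ω, B.eval (z - ζ) ≠ 0) ∧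
      ∀ z ∈ compactPart Ω m, ‖A.eval (z - ζ) / B.eval (z - ζ) - extZero f.1 z‖ < ε := by
  by_cases hne : Ω.Nonempty
  swap
  · rw [Set.not_nonempty_iff_eq_empty] at hne
    subst hne
    exact ⟨1, 1, one_ne_zero, isCoprime_one_left, fun z hz => hz.elim,
      fun z hz => (compactPart_subset ∅ m hz).elim⟩
  obtain ⟨z₀, hz₀⟩ := hne
  obtain ⟨A, B, hB, hAB⟩ := exists_rational_approx hΩ (isCompact_compactPart Ω m)
    (compactPart_subset Ω m) (compactPart_separation Ω m) ζ f.2 (half_pos hε)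
  by_cases hA : A = 0
  -- The zero function is useless for the perturbation, since `0` is coprime only to units; a small
  -- constant replaces it.
  · refine ⟨C ((ε / 4 : ℝ) : ℂ), 1, ?_, isCoprime_one_right, by simp, fun z hz => ?_⟩
    · rw [Ne, C_eq_zero, Complex.ofReal_eq_zero]
      positivity
    · have h1 := hAB z hz
      simp only [hA, eval_zero, zero_div, zero_sub, norm_neg] at h1
      rw [eval_C, eval_one, div_one]
      refine (norm_sub_le _ _).trans_lt ?_
      rw [Complex.norm_real, Real.norm_of_nonneg (by positivity)]
      linarith
  · have hBne : B ≠ 0 := fun h => hB z₀ hz₀ (by simp [h])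
    set R := algebraMap ℂ[X] (RatFunc ℂ) A / algebraMap ℂ[X] (RatFunc ℂ) B
    have hR : R.num * B = A * R.denom := num_mul_eq_mul_denom hBne
    have hden : ∀ z ∈ Ω, R.denom.eval (z - ζ) ≠ 0 := fun z hz h =>
      hB z hz (eval_eq_zero_of_dvd_of_eval_eq_zero (RatFunc.denom_div_dvd A B) h)
    refine ⟨R.num, R.denom, ?_, RatFunc.isCoprime_num_denom R, hden, fun z hz => ?_⟩
    · intro h
      rw [h, zero_mul, eq_comm, mul_eq_zero] at hR
      exact hR.elim hA R.denom_ne_zero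
    · have hzΩ := compactPart_subset Ω m hz
      have h1 := congrArg (Polynomial.eval (z - ζ)) hR
      rw [eval_mul, eval_mul] at h1
      rw [(div_eq_div_iff (hden z hzΩ) (hB z hzΩ)).mpr h1]
      linarith [hAB z hz]

/-- The approximating `h k` is taken at level `k` rather than `m`, so that one sequence both
converges to `f` and, the sets being antitone in the level, eventually lies in the union at level
`m`. -/
theorem dense_iUnion_approxSet (hΩ : IsOpen Ω) {ζ : ℂ} (hζ : ζ ∈ Ω) {F : Set (ℕ × ℕ)}
    (hF : ∀ a b : ℕ, ∃ x ∈ F, a ≤ x.1 ∧ b < x.2) (m : ℕ) :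
    Dense (⋃ x ∈ F, approxSet Ω ζ x.1 x.2 m) := by
  intro f
  have hex : ∀ k : ℕ, ∃ h : Hol Ω, (∃ x ∈ F, h ∈ approxSet Ω ζ x.1 x.2 k) ∧
      ∀ z ∈ compactPart Ω k, ‖extZero h.1 z - extZero f.1 z‖ < 1 / ((k : ℝ) + 1) := by
    intro k
    have hε : 0 < 1 / ((k : ℝ) + 1) := by positivity
    obtain ⟨A, B, hA, hco, hB, hAB⟩ := exists_coprime_rational_approx hΩ ζ f k (half_pos hε)
    obtain ⟨x, hx, hx1, hx2⟩ := hF A.natDegree B.natDegree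
    obtain ⟨h, hh, hhA⟩ :=
      exists_mem_approxSet_near_rational hΩ hζ hA hco hB hx1 hx2 k (half_pos hε)
    refine ⟨h, ⟨x, hx, hh⟩, fun z hz => ?_⟩
    have h1 := norm_sub_le_norm_sub_add_norm_sub (extZero h.1 z)
      (A.eval (z - ζ) / B.eval (z - ζ)) (extZero f.1 z)
    linarith [hhA z hz, hAB z hz]
  choose h hh hlt using hex
  refine mem_closure_of_tendsto (tendsto_hol_of_norm_sub_lt hΩ hlt) ?_
  filter_upwards [eventually_ge_atTop m] with k hk
  obtain ⟨x, hx, hxk⟩ := hh k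
  exact Set.mem_biUnion hx (approxSet_anti Ω ζ x.1 x.2 hk hxk)

/-! ### The `G_δ` representation and the conclusion by Baire's theorem -/

/-- One pair chosen at each level `m` already forms the required sequence, because every compact
subset of `Ω` lies in all late members of the exhaustion; the pairs may repeat. -/
theorem universalSet_eq_iInter (hΩ : IsOpen Ω) (F : Set (ℕ × ℕ)) (ζ : ℂ) :
    universalSet Ω F ζ = ⋂ m, ⋃ x ∈ F, approxSet Ω ζ x.1 x.2 m := by
  ext f
  simp only [Set.mem_iInter, Set.mem_iUnion, exists_prop]
  constructor
  · rintro ⟨s, hsF, hsD, hs⟩ m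
    obtain ⟨h1, h2⟩ := hs _ (isCompact_compactPart Ω m) (compactPart_subset Ω m)
    rw [Metric.tendstoUniformlyOn_iff] at h2
    obtain ⟨n, hn1, hn2⟩ := (h1.and (h2 (1 / ((m : ℝ) + 1)) (by positivity))).exists
    refine ⟨s n, hsF n, hsD n, fun z hz => ⟨hn1 z hz, ?_⟩⟩
    rw [← dist_eq_norm, dist_comm]
    exact hn2 z hz
  · intro h
    choose s hsF hs using h
    refine ⟨s, hsF, fun n => (hs n).1, fun K hK hKΩ => ?_⟩
    obtain ⟨m₀, hm₀⟩ := exists_subset_compactPart hΩ hK hKΩ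
    refine ⟨?_, ?_⟩
    · filter_upwards [eventually_ge_atTop m₀] with n hn z hz
      exact ((hs n).2 z (compactPart_mono Ω hn (hm₀ hz))).1
    · rw [Metric.tendstoUniformlyOn_iff]
      intro ε hε
      have h0 := tendsto_one_div_add_atTop_nhds_zero_nat (𝕜 := ℝ)
      filter_upwards [eventually_ge_atTop m₀, h0.eventually_lt_const hε] with n hn hnε z hz
      rw [dist_comm, dist_eq_norm]
      exact ((hs n).2 z (compactPart_mono Ω hn (hm₀ hz))).2.trans hnε

end PadeGeneric

end

theorem theorem5p5 (Ω : Set ℂ) (hΩ : IsOpen Ω) (F : Set (ℕ × ℕ))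
    (hF : ∃ s : ℕ → ℕ × ℕ, (∀ n, s n ∈ F) ∧
      Filter.Tendsto (fun n => (s n).1) Filter.atTop Filter.atTop ∧
      Filter.Tendsto (fun n => (s n).2) Filter.atTop Filter.atTop)
    (ζ₀ : ℂ) (hζ₀ : ζ₀ ∈ Ω) :
    (∃ f : PadeGeneric.Hol Ω, f ∈ PadeGeneric.universalSet Ω F ζ₀) ∧
      IsGδ (PadeGeneric.universalSet Ω F ζ₀) ∧
      Dense (PadeGeneric.universalSet Ω F ζ₀) := by
  have hF' : ∀ a b : ℕ, ∃ x ∈ F, a ≤ x.1 ∧ b < x.2 := by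
    intro a b
    obtain ⟨s, hs, h1, h2⟩ := hF
    obtain ⟨n, hn1, hn2⟩ :=
      ((h1.eventually (eventually_ge_atTop a)).and (h2.eventually (eventually_gt_atTop b))).exists
    exact ⟨s n, hs n, hn1, hn2⟩
  have hopen : ∀ m, IsOpen (⋃ x ∈ F, PadeGeneric.approxSet Ω ζ₀ x.1 x.2 m) := fun m =>
    isOpen_biUnion fun x _ => PadeGeneric.isOpen_approxSet hΩ hζ₀ x.1 x.2 m
  have := PadeGeneric.baireSpace_hol hΩ
  have hdense : Dense (PadeGeneric.universalSet Ω F ζ₀) := by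
    rw [PadeGeneric.universalSet_eq_iInter hΩ]
    exact dense_iInter_of_isOpen_nat hopen (PadeGeneric.dense_iUnion_approxSet hΩ hζ₀ hF')
  have : Nonempty (PadeGeneric.Hol Ω) :=
    ⟨PadeGeneric.holOfDifferentiableOn 0 (differentiableOn_const 0)⟩
  refine ⟨hdense.nonempty, ?_, hdense⟩
  rw [PadeGeneric.universalSet_eq_iInter hΩ]
  exact IsGδ.iInter_of_isOpen hopen
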